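/- Let $X$ be a locally compact Hausdorff space, $\mathfrak M^+$ the cone of positive Radon measures on $X$ with the vague topology (pointwise convergence on continuous functions of compact support), and let $\kappa:X\times X\to(-\infty,\infty]$ be a kernel, i.e. a symmetric lower semicontinuous function, with $\kappa\ge 0$ unless $X$ is compact. For $\mu,\nu\in\mathfrak M^+$ put $\kappa\mu(x)=\int\kappa(x,y)\,d\mu(y)$, $\kappa(\mu,\nu)=\int\kappa\,d(\mu\otimes\nu)$, and let $\mathcal E^+$ be the set of $\mu\in\mathfrak M^+$ with $\kappa(\mu,\mu)<\infty$. Assume that $\kappa$ is perfect, that is: (i) $\kappa$ is positive definite, i.e. $\kappa(\mu,\mu)\ge0$ for all signed Radon measures $\mu$ for which the energy is well defined, so that $\|\mu-\nu\|=\sqrt{\kappa(\mu-\nu,\mu-\nu)}$ is a pseudometric on $\mathcal E^+$, whose topology is called strong; (ii) $\|\mu-\nu\|=0$ with $\mu,\nu\in\mathcal E^+$ implies $\mu=\nu$; (iii) every strong Cauchy net in $\mathcal E^+$ converges strongly to each of its vague limit (cluster) points. For $A\subset X$ let $c_*(A)=1/\inf\kappa(\mu,\mu)\in[0,\infty]$,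 where $1/0=\infty$, $1/\infty=0$, and the infimum (equal to $\infty$ over the empty class) is over all $\mu\in\mathcal E^+$ with $\mu(X)=1$ that are concentrated on $A$ (i.e. $X\setminus A$ is locally $\mu$-negligible). A property holds n.e. on $A$ if $c_*(E)=0$ for the set $E\subset A$ of points where it fails. Let $\Gamma_A^+=\{\nu\in\mathcal E^+:\kappa\nu\ge1\text{ n.e. on }A\}$, and let $\gamma_A$ denote the measure of minimum energy $\kappa(\nu,\nu)$ among $\nu\in\Gamma_A^+$. Let $\mathfrak C_A$ be the set of all compact subsets of $A$, directed upward by inclusion; limits as $K\uparrow A$ are along $\mathfrak C_A$. Let $A\subset X$ be arbitrary with $c_*(A)<\infty$. Then $\gamma_A$, and $\gamma_K$ for every $K\in\mathfrak C_A$, exist and are unique, and $$\gamma_K\to\gamma_A\quad\text{strongly and vaguely in }\mathcal E^+\text{ as }K\uparrow A.$$ Suppose moreover that the first maximum principle (if $\mu\in\mathfrak M^+$ and $\kappa\mu\le1$ on the support of $\mu$, then $\kappa\mu\le1$ on $X$) and the second maximum principle (if $\mu,\nu\in\mathcal E^+$ and $\kappa\mu\le\kappa\nu$ $\mu$-a.e.,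 then $\kappa\mu\le\kappa\nu$ on $X$) both hold. Then also $\kappa\gamma_K\uparrow\kappa\gamma_A$ pointwise on $X$ as $K\uparrow A$, i.e. for every $x\in X$ the net $(\kappa\gamma_K(x))_{K\in\mathfrak C_A}$ is increasing in $K$ and converges to $\kappa\gamma_A(x)$, and hence $$\kappa\gamma_A=\sup_{K\in\mathfrak C_A}\kappa\gamma_K\quad\text{on }X.$$ -/

import Mathlib

open MeasureTheory Filter Topology
open scoped ENNReal

namespace PotentialTheory

section

variable {X : Type*} [TopologicalSpace X] [MeasurableSpace X]

/-- A positive (scalar) Radon measure on a locally compact Hausdorff space with its Borel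
`σ`-algebra: a Borel measure that is finite on compact sets, outer regular, and inner regular on
open sets by compact sets. By the Riesz representation theorem these are exactly the positive
linear functionals on the continuous functions of compact support, and the measure of an arbitrary
set is its Bourbaki outer measure. -/
@[ext] structure RadonMeasure (X : Type*) [TopologicalSpace X] [MeasurableSpace X] where
  toMeasure : Measure X
  regular : toMeasure.Regular

/-- The vague topology: pointwise convergence on continuous functions of compact support. -/
noncomputable instance : TopologicalSpace (RadonMeasure X) :=
  TopologicalSpace.induced
    (fun (μ : RadonMeasure X) (f : CompactlySupportedContinuousMap X ℝ) => ∫ x, f x ∂μ.toMeasure)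
    inferInstance

noncomputable instance : Zero (RadonMeasure X) := ⟨⟨0, inferInstance⟩⟩

/-- A kernel on `X`: a symmetric, lower semicontinuous function with values in `(-∞, ∞]`, which is
nonnegative unless `X` is compact. -/
structure IsKernel (κ : X → X → EReal) : Prop where
  symm : ∀ x y, κ x y = κ y x
  lsc : LowerSemicontinuous (fun p : X × X => κ p.1 p.2)
  ne_bot : ∀ x y, κ x y ≠ ⊥
  nonneg : ¬ CompactSpace X → ∀ x y, 0 ≤ κ x y

/-- The potential `κμ(x) = ∫ κ(x,y) dμ(y)` of a positive measure, as the integral of the positive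
part minus the integral of the negative part. For a kernel the second integral is always finite
(it is zero unless `X` is compact, and then the kernel is bounded below and `μ` is finite). -/
noncomputable def potential (κ : X → X → EReal) (μ : RadonMeasure X) (x : X) : EReal :=
  ((∫⁻ y, (κ x y).toENNReal ∂μ.toMeasure : ℝ≥0∞) : EReal) -
    ((∫⁻ y, (-κ x y).toENNReal ∂μ.toMeasure : ℝ≥0∞) : EReal)

/-- The mutual energy `κ(μ,ν) = ∫∫ κ(x,y) dν(y) dμ(x)` of two positive measures. The iterated
integral is used because `X` need not be second countable; for semicontinuous integrands it equals
the integral against the Radon product measure (Fubini). As for potentials, the integral of the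
negative part is finite for a kernel. -/
noncomputable def mutualEnergy (κ : X → X → EReal) (μ ν : RadonMeasure X) : EReal :=
  ((∫⁻ x, ∫⁻ y, (κ x y).toENNReal ∂ν.toMeasure ∂μ.toMeasure : ℝ≥0∞) : EReal) -
    ((∫⁻ x, ∫⁻ y, (-κ x y).toENNReal ∂ν.toMeasure ∂μ.toMeasure : ℝ≥0∞) : EReal)

/-- The energy `κ(μ,μ)` of a positive measure. -/
noncomputable def energy (κ : X → X → EReal) (μ : RadonMeasure X) : EReal := mutualEnergy κ μ μ

/-- The cone `𝓔⁺` of positive measures of finite energy (the energy is never `-∞`). -/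
def FiniteEnergy (κ : X → X → EReal) : Set (RadonMeasure X) := {μ | energy κ μ < ⊤}

/-- `μ` is concentrated on `A`: the complement of `A` is locally `μ`-negligible. -/
def ConcentratedOn (μ : RadonMeasure X) (A : Set X) : Prop :=
  ∀ K : Set X, IsCompact K → μ.toMeasure (K \ A) = 0

/-- `w(A)`: the infimum of the energy over the unit measures of finite energy concentrated on `A`.
The infimum over the empty class is `∞`. -/
noncomputable def minEnergy (κ : X → X → EReal) (A : Set X) : ℝ≥0∞ :=
  ⨅ μ ∈ {μ : RadonMeasure X |
    μ ∈ FiniteEnergy κ ∧ ConcentratedOn μ A ∧ μ.toMeasure Set.univ = 1}, (energy κ μ).toENNReal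

/-- The (Wiener) inner capacity `c_*(A) = 1 / w(A)`, with `1 / 0 = ∞` and `1 / ∞ = 0`. -/
noncomputable def innerCapacity (κ : X → X → EReal) (A : Set X) : ℝ≥0∞ := (minEnergy κ A)⁻¹

/-- `P` holds nearly everywhere (n.e.) on `A`. -/
def NearlyEverywhereOn (κ : X → X → EReal) (A : Set X) (P : X → Prop) : Prop :=
  innerCapacity κ {x | x ∈ A ∧ ¬ P x} = 0

/-- The kernel is positive definite. Every real-valued Radon measure is a difference `μ - ν` of
positive ones, and its energy is `κ(μ,μ) + κ(ν,ν) - 2κ(μ,ν)` whenever it is well defined; the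
inequality holds trivially if both `κ(μ,μ) + κ(ν,ν)` and `κ(μ,ν)` are infinite. -/
def PositiveDefinite (κ : X → X → EReal) : Prop :=
  ∀ μ ν : RadonMeasure X, 2 * mutualEnergy κ μ ν ≤ energy κ μ + energy κ ν

/-- The strong distance `‖μ - ν‖ = √κ(μ - ν, μ - ν)` between `μ, ν ∈ 𝓔⁺`; for a positive definite
kernel the three energies are finite and the radicand is nonnegative. -/
noncomputable def strongDist (κ : X → X → EReal) (μ ν : RadonMeasure X) : ℝ :=
  √((energy κ μ).toReal + (energy κ ν).toReal - 2 * (mutualEnergy κ μ ν).toReal)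

/-- Strong convergence along a filter, towards a measure of finite energy, of measures that are
eventually of finite energy. -/
def StrongTendsto (κ : X → X → EReal) {ι : Type*} (m : ι → RadonMeasure X) (F : Filter ι)
    (μ : RadonMeasure X) : Prop :=
  (∀ᶠ i in F, m i ∈ FiniteEnergy κ) ∧ μ ∈ FiniteEnergy κ ∧
    Tendsto (fun i => strongDist κ (m i) μ) F (𝓝 0)

/-- The energy principle: the energy seminorm is a norm. -/
def EnergyPrinciple (κ : X → X → EReal) : Prop :=
  ∀ μ ∈ FiniteEnergy κ, ∀ ν ∈ FiniteEnergy κ, strongDist κ μ ν = 0 → μ = ν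

/-- Consistency: every strong Cauchy net in `𝓔⁺` converges strongly to each of its vague limit
(cluster) points. Nets are expressed by the filters they generate. -/
def Consistent (κ : X → X → EReal) : Prop :=
  ∀ F : Filter (RadonMeasure X), F.NeBot → (∀ᶠ μ in F, μ ∈ FiniteEnergy κ) →
    (∀ ε : ℝ, 0 < ε → ∃ S ∈ F, ∀ μ ∈ S, ∀ ν ∈ S, strongDist κ μ ν < ε) →
    ∀ μ : RadonMeasure X, ClusterPt μ F → StrongTendsto κ id F μ

/-- A perfect kernel: positive definite, with the energy principle and consistency. -/
structure IsPerfect (κ : X → X → EReal) : Prop where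
  posDef : PositiveDefinite κ
  energyPrinciple : EnergyPrinciple κ
  consistent : Consistent κ

/-- Frostman's maximum principle (the first maximum principle). -/
def FirstMaximumPrinciple (κ : X → X → EReal) : Prop :=
  ∀ μ : RadonMeasure X, (∀ x ∈ μ.toMeasure.support, potential κ μ x ≤ 1) →
    ∀ x, potential κ μ x ≤ 1

/-- The domination principle (the second maximum principle). -/
def SecondMaximumPrinciple (κ : X → X → EReal) : Prop :=
  ∀ μ ∈ FiniteEnergy κ, ∀ ν ∈ FiniteEnergy κ,
    (∀ᵐ x ∂μ.toMeasure, potential κ μ x ≤ potential κ ν x) →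
    ∀ x, potential κ μ x ≤ potential κ ν x

/-- The class `Γ_A⁺` of all `ν ∈ 𝓔⁺` with `κν ≥ 1` n.e. on `A`. -/
def Gam (κ : X → X → EReal) (A : Set X) : Set (RadonMeasure X) :=
  {ν | ν ∈ FiniteEnergy κ ∧ NearlyEverywhereOn κ A (fun x => 1 ≤ potential κ ν x)}

/-- `γ` solves the minimum energy problem over `Γ_A⁺`. -/
def IsInnerCapacitaryMeasure (κ : X → X → EReal) (A : Set X) (γ : RadonMeasure X) : Prop :=
  γ ∈ Gam κ A ∧ ∀ ν ∈ Gam κ A, energy κ γ ≤ energy κ ν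

open Classical in
/-- The inner capacitary measure `γ_A`: the measure of minimum energy in `Γ_A⁺` (and zero if there
is none). -/
noncomputable def innerCapacitaryMeasure (κ : X → X → EReal) (A : Set X) : RadonMeasure X :=
  if h : ∃ γ, IsInnerCapacitaryMeasure κ A γ then h.choose else 0

/-- The upward directed set `𝔠_A` of compact subsets of `A`, ordered by inclusion. -/
abbrev CompactSubsets (A : Set X) : Type _ :=
  {K : TopologicalSpace.Compacts X // (K : Set X) ⊆ A}

end

end PotentialTheory

open PotentialTheory

/-! The argument is convexity in the pre-Hilbert geometry of the energy. By `mem_Gam_iff`, a measure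
`ν` of finite energy lies in `Γ_A⁺` exactly when `κ(μ,ν) ≥ μ(X)` for every `μ` of finite energy
carried by a compact subset of `A`. These conditions are affine in `ν`, stable under strong limits,
and weaker for smaller sets. The parallelogram law `sqDist_eq_midpoint` and the energy principle
then give uniqueness of minimizers.

For compact `K`, normalizing a unit measure of minimal energy gives `γ_K`; its energy equals its
mass and is at most `1/b`, where `b > 0` comes from the finite capacity of `A`. Since `Γ_L⁺ ⊆ Γ_K⁺`
for `K ⊆ L`, the energies of the `γ_K` increase to a finite limit, so the parallelogram law makes
the net strong Cauchy. Strong boundedness bounds masses on compact sets (`exists_measure_sq_le`), so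
vague compactness and consistency yield a strong and vague limit. It satisfies the constraints for
`A`, and its energy does not exceed that of any competitor in `Γ_A⁺ ⊆ Γ_K⁺`; hence it is `γ_A`,
whose existence is thereby proved.

For potentials, `κγ_K = 1` holds `γ_K`-a.e. (`potential_eq_one_ae`), so domination gives `κγ_K ≤ κν`
everywhere for `ν ∈ Γ_K⁺`. This yields monotonicity and `sup κγ_K ≤ κγ_A`; vague lower
semicontinuity of the potential gives the reverse inequality.

Measures need not be `σ`-finite, so integrals of lower semicontinuous functions are computed as
directed suprema over `C_c` minorants. Negative values of `κ` are absorbed by a constant `c` with `κ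
+ c ≥ 0`, which is nonzero only if `X` is compact and all masses are finite. -/

namespace PotentialTheory

open scoped NNReal CompactlySupported
open Set

set_option linter.unusedSectionVars false

/-! ### Monotone convergence for directed families of lower semicontinuous functions -/

section Semicontinuous

variable {X : Type*} [TopologicalSpace X]

/-- Riemann sums (mesh `1 / (n + 1)`) of the layer-cake formula for `t`. -/
noncomputable def layerSum (n : ℕ) (t : ℝ≥0∞) : ℝ≥0∞ :=
  ∑ k ∈ Finset.range ((n + 1) ^ 2),
    (n + 1 : ℝ≥0∞)⁻¹ * (Ioi ((k + 1 : ℝ≥0∞) * (n + 1 : ℝ≥0∞)⁻¹)).indicator 1 t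

/-- The bound by `N * δ` makes the induction close: when the new level `(N + 1) * δ` is below `t`,
the enlarged sum is at most that level, hence below `t`. -/
theorem sum_layer_le (δ t : ℝ≥0∞) (N : ℕ) :
    ∑ k ∈ Finset.range N, δ * (Ioi ((k + 1 : ℝ≥0∞) * δ)).indicator 1 t ≤ min t (N * δ) := by
  induction N with
  | zero => simp
  | succ N ih =>
    rw [Finset.sum_range_succ]
    by_cases h : ((N : ℝ≥0∞) + 1) * δ < t
    · have : (Ioi ((N + 1 : ℝ≥0∞) * δ)).indicator (1 : ℝ≥0∞ → ℝ≥0∞) t = 1 :=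
        indicator_of_mem (by exact h) _
      rw [this, mul_one]
      have h1 : ∑ k ∈ Finset.range N, δ * (Ioi ((k + 1 : ℝ≥0∞) * δ)).indicator 1 t + δ
          ≤ ((N : ℝ≥0∞) + 1) * δ := by
        rw [add_mul, one_mul]
        gcongr
        exact ih.trans (min_le_right _ _)
      refine le_min (h1.trans h.le) ?_
      push_cast
      exact h1
    · have : (Ioi ((N + 1 : ℝ≥0∞) * δ)).indicator (1 : ℝ≥0∞ → ℝ≥0∞) t = 0 :=
        indicator_of_notMem (by exact h) _
      rw [this, mul_zero, add_zero]
      refine ih.trans (min_le_min_left _ ?_)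
      gcongr
      simp

theorem layerSum_le (n : ℕ) (t : ℝ≥0∞) : layerSum n t ≤ t :=
  (sum_layer_le _ _ _).trans (min_le_left _ _)

theorem mul_le_layerSum {n M : ℕ} {t : ℝ≥0∞} (hM : M ≤ (n + 1) ^ 2)
    (ht : (M : ℝ≥0∞) * (n + 1 : ℝ≥0∞)⁻¹ < t) :
    (M : ℝ≥0∞) * (n + 1 : ℝ≥0∞)⁻¹ ≤ layerSum n t := by
  calc (M : ℝ≥0∞) * (n + 1 : ℝ≥0∞)⁻¹ = ∑ k ∈ Finset.range M, (n + 1 : ℝ≥0∞)⁻¹ := by simp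
    _ = ∑ k ∈ Finset.range M,
        (n + 1 : ℝ≥0∞)⁻¹ * (Ioi ((k + 1 : ℝ≥0∞) * (n + 1 : ℝ≥0∞)⁻¹)).indicator 1 t := by
      refine Finset.sum_congr rfl fun k hk => ?_
      rw [indicator_of_mem, Pi.one_apply, mul_one]
      refine lt_of_le_of_lt ?_ ht
      gcongr
      exact_mod_cast Finset.mem_range.1 hk
    _ ≤ layerSum n t :=
      Finset.sum_le_sum_of_subset (Finset.range_mono hM)

theorem le_liminf_layerSum (t : ℝ≥0∞) : t ≤ liminf (fun n => layerSum n t) atTop := by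
  refine le_of_forall_lt fun c hc => ?_
  obtain ⟨d, hcd, hdt⟩ := ENNReal.lt_iff_exists_nnreal_btwn.1 hc
  lift c to ℝ≥0 using hc.ne_top
  have hcd' : c < d := by exact_mod_cast hcd
  obtain ⟨e, hce, hed⟩ := exists_between hcd'
  refine lt_of_lt_of_le (b := (e : ℝ≥0∞)) (by exact_mod_cast hce) ?_
  refine le_liminf_of_le (by isBoundedDefault) ?_
  obtain ⟨n₁, hn₁⟩ := exists_nat_one_div_lt (show (0 : ℝ) < d - e by
    have : (e : ℝ) < d := by exact_mod_cast hed
    linarith)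
  obtain ⟨n₂, hn₂⟩ := exists_nat_ge d
  filter_upwards [eventually_ge_atTop n₁, eventually_ge_atTop n₂] with n h1 h2
  -- `M` counts the mesh points up to `d`. The `(n + 1) ^ 2` levels of mesh `1 / (n + 1)` reach
  -- height `n + 1`, hence `d` once `n ≥ d`; rounding loses less than `d - e` once `n ≥ n₁`.
  set M := ⌊d * (n + 1)⌋₊ with hMdef
  have hpos : (0 : ℝ≥0) < n + 1 := by positivity
  have hMle : (M : ℝ≥0) ≤ d * (n + 1) := Nat.floor_le (by positivity)
  have hM : M ≤ (n + 1) ^ 2 := by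
    have h3 : (M : ℝ≥0) ≤ (n + 1) ^ 2 := by
      refine hMle.trans ?_
      rw [sq]
      gcongr
      have : (n₂ : ℝ≥0) ≤ n := by exact_mod_cast h2
      exact (hn₂.trans this).trans (by simp)
    exact_mod_cast h3
  have hcast : (M : ℝ≥0∞) * (n + 1 : ℝ≥0∞)⁻¹ = (((M : ℝ≥0) * ((n : ℝ≥0) + 1)⁻¹ : ℝ≥0) : ℝ≥0∞) := by
    rw [ENNReal.coe_mul, ENNReal.coe_inv hpos.ne']
    push_cast
    rfl
  have hle : ((M : ℝ≥0) * ((n : ℝ≥0) + 1)⁻¹) ≤ d := by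
    rw [← div_eq_mul_inv, div_le_iff₀ hpos]
    exact hMle
  refine le_trans ?_ (mul_le_layerSum hM ?_)
  · rw [hcast, ENNReal.coe_le_coe, ← div_eq_mul_inv, le_div_iff₀ hpos]
    have h4 : d * (n + 1) < M + 1 := Nat.lt_floor_add_one _
    have h5 : (1 : ℝ) / (n + 1) < d - e := by
      refine lt_of_le_of_lt ?_ hn₁
      have : (n₁ : ℝ) ≤ n := by exact_mod_cast h1
      gcongr
    have h6 : (d : ℝ) * (n + 1) < M + 1 := by exact_mod_cast h4
    have h7 : (0 : ℝ) < n + 1 := by positivity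
    rw [div_lt_iff₀ h7] at h5
    have h8 : (e : ℝ) * (n + 1) ≤ M := by nlinarith
    exact_mod_cast h8
  · rw [hcast]
    exact lt_of_le_of_lt (by exact_mod_cast hle) hdt

variable [MeasurableSpace X] [BorelSpace X]

/-- A regular measure is continuous along directed unions of open sets. -/
theorem measure_iUnion_of_directed_isOpen (μ : Measure X) [μ.Regular] {ι : Type*} [Nonempty ι]
    {U : ι → Set X} (hU : ∀ i, IsOpen (U i)) (hd : Directed (· ⊆ ·) U) :
    μ (⋃ i, U i) = ⨆ i, μ (U i) := by
  refine le_antisymm ?_ (iSup_le fun i => measure_mono (subset_iUnion _ _))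
  rw [(isOpen_iUnion hU).measure_eq_iSup_isCompact]
  refine iSup₂_le fun K hK => iSup_le fun hKc => ?_
  obtain ⟨i, hi⟩ := hKc.elim_directed_cover U hU hK hd
  exact le_iSup_of_le i (measure_mono hi)

/-- Monotone convergence for directed families of lower semicontinuous functions. -/
theorem lintegral_iSup_of_directed_lowerSemicontinuous (μ : Measure X) [μ.Regular] {ι : Type*}
    [Nonempty ι] {g : ι → X → ℝ≥0∞} (hg : ∀ i, LowerSemicontinuous (g i))
    (hd : Directed (· ≤ ·) g) :
    ∫⁻ x, ⨆ i, g i x ∂μ = ⨆ i, ∫⁻ x, g i x ∂μ := by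
  refine le_antisymm ?_ (iSup_le fun i => lintegral_mono fun x => le_iSup (fun i => g i x) i)
  have hG : LowerSemicontinuous fun x => ⨆ i, g i x := lowerSemicontinuous_iSup hg
  have key : ∀ (n : ℕ) (f : X → ℝ≥0∞), LowerSemicontinuous f →
      ∫⁻ x, layerSum n (f x) ∂μ = ∑ k ∈ Finset.range ((n + 1) ^ 2),
        (n + 1 : ℝ≥0∞)⁻¹ * μ (f ⁻¹' Ioi ((k + 1 : ℝ≥0∞) * (n + 1 : ℝ≥0∞)⁻¹)) := by
    intro n f hf
    have hm : ∀ a : ℝ≥0∞, MeasurableSet (f ⁻¹' Ioi a) := fun a =>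
      (hf.isOpen_preimage a).measurableSet
    have hi : ∀ a : ℝ≥0∞, (fun x => (Ioi a).indicator (1 : ℝ≥0∞ → ℝ≥0∞) (f x)) =
        (f ⁻¹' Ioi a).indicator 1 := fun a => rfl
    unfold layerSum
    rw [lintegral_finsetSum]
    · refine Finset.sum_congr rfl fun k _ => ?_
      rw [lintegral_const_mul]
      · rw [hi, lintegral_indicator_one (hm _)]
      · rw [hi]
        exact measurable_one.indicator (hm _)
    · intro k _
      refine Measurable.const_mul ?_ _
      rw [hi]
      exact measurable_one.indicator (hm _)
  -- Fatou is applied to the sequence of layer sums, not to the uncountable family. Each layer sum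
  -- integrates to a finite combination of measures of open sets, and these commute with directed
  -- suprema.
  calc ∫⁻ x, ⨆ i, g i x ∂μ
      ≤ ∫⁻ x, liminf (fun n => layerSum n (⨆ i, g i x)) atTop ∂μ :=
        lintegral_mono fun x => le_liminf_layerSum _
    _ ≤ liminf (fun n => ∫⁻ x, layerSum n (⨆ i, g i x) ∂μ) atTop := by
        refine lintegral_liminf_le fun n => ?_
        have hl : Measurable (layerSum n) := by
          unfold layerSum
          refine Finset.measurable_sum _ fun k _ => ?_
          exact (measurable_one.indicator measurableSet_Ioi).const_mul _
        exact hl.comp hG.measurable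
    _ ≤ ⨆ i, ∫⁻ x, g i x ∂μ := by
        refine liminf_le_of_le (by isBoundedDefault) fun b hb => ?_
        obtain ⟨n, hn⟩ := hb.exists
        refine hn.trans ?_
        rw [key n _ hG]
        have hpre : ∀ a : ℝ≥0∞, (fun x => ⨆ i, g i x) ⁻¹' Ioi a = ⋃ i, g i ⁻¹' Ioi a := by
          intro a
          ext x
          simp [lt_iSup_iff]
        have hdir : ∀ a : ℝ≥0∞, Directed (· ⊆ ·) fun i => g i ⁻¹' Ioi a := by
          intro a i j
          obtain ⟨k, hik, hjk⟩ := hd i j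
          exact ⟨k, fun x hx => lt_of_lt_of_le hx (hik x), fun x hx => lt_of_lt_of_le hx (hjk x)⟩
        simp_rw [hpre, measure_iUnion_of_directed_isOpen μ
          (fun i => (hg i).isOpen_preimage _) (hdir _), ENNReal.mul_iSup]
        rw [ENNReal.finsetSum_iSup]
        · refine iSup_mono fun i => ?_
          rw [← key n _ (hg i)]
          exact lintegral_mono fun x => layerSum_le _ _
        · intro i j
          obtain ⟨k, hik, hjk⟩ := hd i j
          refine ⟨k, fun a => ⟨?_, ?_⟩⟩
          · gcongr
            exact fun x hx => lt_of_lt_of_le hx (hik x)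
          · gcongr
            exact fun x hx => lt_of_lt_of_le hx (hjk x)

end Semicontinuous

/-! ### Lower semicontinuous functions as suprema of `C_c` minorants -/

section Minorants

variable {Y : Type*} [TopologicalSpace Y]

/-- The nonnegative continuous functions of compact support below `f`. -/
abbrev Minorant (f : Y → ℝ≥0∞) : Type _ := {h : C_c(Y, ℝ≥0) // ∀ y, (h y : ℝ≥0∞) ≤ f y}

instance (f : Y → ℝ≥0∞) : Nonempty (Minorant f) := ⟨⟨0, fun y => by simp⟩⟩

theorem directed_minorant (f : Y → ℝ≥0∞) :
    Directed (· ≤ ·) fun (h : Minorant f) (y : Y) => (h.1 y : ℝ≥0∞) := by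
  intro h₁ h₂
  refine ⟨⟨h₁.1 ⊔ h₂.1, fun y => ?_⟩, fun y => ?_, fun y => ?_⟩
  · rw [CompactlySupportedContinuousMap.sup_apply, ENNReal.coe_max]
    exact max_le (h₁.2 y) (h₂.2 y)
  · simp
  · simp

/-- For `d < f y`, a Urysohn function equal to `1` at `y` and vanishing off the open set `{d < f}`,
multiplied by `d`, is a minorant with value `d` at `y`. -/
theorem iSup_minorant [T2Space Y] [LocallyCompactSpace Y] {f : Y → ℝ≥0∞}
    (hf : LowerSemicontinuous f) (y : Y) : ⨆ h : Minorant f, (h.1 y : ℝ≥0∞) = f y := by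
  refine le_antisymm (iSup_le fun h => h.2 y) ?_
  refine le_of_forall_lt fun c hc => ?_
  obtain ⟨d, hcd, hdf⟩ := ENNReal.lt_iff_exists_nnreal_btwn.1 hc
  have hopen : IsOpen {z | (d : ℝ≥0∞) < f z} := hf.isOpen_preimage _
  obtain ⟨φ, hφ1, hφ0, hφc, hφ⟩ := exists_continuous_one_zero_of_isCompact
    (isCompact_singleton (x := y)) hopen.isClosed_compl
    (by simpa using hdf)
  let ψ : C_c(Y, ℝ) := ⟨φ, hφc⟩
  have hψ : ∀ z, ψ.nnrealPart z = Real.toNNReal (φ z) := fun z => rfl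
  refine lt_of_lt_of_le hcd (le_iSup_of_le ⟨d • ψ.nnrealPart, fun z => ?_⟩ ?_)
  · rw [CompactlySupportedContinuousMap.smul_apply, hψ]
    by_cases hz : (d : ℝ≥0∞) < f z
    · refine le_trans ?_ hz.le
      rw [ENNReal.coe_le_coe, smul_eq_mul]
      refine mul_le_of_le_one_right' ?_
      rw [Real.toNNReal_le_one]
      exact (hφ z).2
    · rw [hφ0 (show z ∈ {z | (d : ℝ≥0∞) < f z}ᶜ from hz)]
      simp
  · rw [CompactlySupportedContinuousMap.smul_apply, hψ, hφ1 rfl]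
    simp

theorem lowerSemicontinuous_coe_compactlySupported (h : C_c(Y, ℝ≥0)) :
    LowerSemicontinuous fun y => (h y : ℝ≥0∞) :=
  (ENNReal.continuous_coe.comp h.continuous).lowerSemicontinuous

variable [T2Space Y] [LocallyCompactSpace Y] [MeasurableSpace Y] [BorelSpace Y]

theorem lintegral_eq_iSup_minorant (μ : Measure Y) [μ.Regular] {f : Y → ℝ≥0∞}
    (hf : LowerSemicontinuous f) :
    ∫⁻ y, f y ∂μ = ⨆ h : Minorant f, ∫⁻ y, (h.1 y : ℝ≥0∞) ∂μ := by
  simp_rw [← iSup_minorant hf]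
  exact lintegral_iSup_of_directed_lowerSemicontinuous μ
    (fun h => lowerSemicontinuous_coe_compactlySupported h.1) (directed_minorant f)

theorem lintegral_coe_eq_ofReal_integral (μ : Measure Y) [IsFiniteMeasureOnCompacts μ]
    (h : C_c(Y, ℝ≥0)) : ∫⁻ y, (h y : ℝ≥0∞) ∂μ = ENNReal.ofReal (∫ y, (h y : ℝ) ∂μ) := by
  rw [ofReal_integral_eq_lintegral_ofReal]
  · simp
  · exact (h.toReal.continuous.integrable_of_hasCompactSupport h.toReal.hasCompactSupport).congr
      (Eventually.of_forall fun y => h.toReal_apply y)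
  · exact Eventually.of_forall fun y => NNReal.coe_nonneg _

end Minorants

/-! ### Tonelli without `σ`-finiteness -/

section Tonelli

variable {X : Type*} [TopologicalSpace X] [T2Space X] [LocallyCompactSpace X]
  [MeasurableSpace X] [BorelSpace X]

theorem hasCompactSupport_uncurry_coe (h : C_c(X × X, ℝ≥0)) :
    HasCompactSupport (Function.uncurry fun x y => (h (x, y) : ℝ)) := by
  convert h.toReal.hasCompactSupport using 1
  ext p
  simp [Function.uncurry]

theorem continuous_uncurry_coe (h : C_c(X × X, ℝ≥0)) :
    Continuous (Function.uncurry fun x y => (h (x, y) : ℝ)) :=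
  NNReal.continuous_coe.comp h.continuous

theorem hasCompactSupport_slice (h : C_c(X × X, ℝ≥0)) (x : X) :
    HasCompactSupport fun y => h (x, y) := by
  refine HasCompactSupport.intro (h.hasCompactSupport.isCompact.image continuous_snd) fun y hy => ?_
  by_contra hne
  exact hy ⟨(x, y), subset_tsupport _ hne, rfl⟩

/-- The section `h(x, ·)` of a continuous function of compact support. -/
def sliceRight (h : C_c(X × X, ℝ≥0)) (x : X) : C_c(X, ℝ≥0) :=
  ⟨⟨fun y => h (x, y), by fun_prop⟩, hasCompactSupport_slice h x⟩

theorem lintegral_slice (ν : Measure X) [IsFiniteMeasureOnCompacts ν] (h : C_c(X × X, ℝ≥0))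
    (x : X) : ∫⁻ y, (h (x, y) : ℝ≥0∞) ∂ν = ENNReal.ofReal (∫ y, (h (x, y) : ℝ) ∂ν) :=
  lintegral_coe_eq_ofReal_integral ν (sliceRight h x)

theorem continuous_integral_slice (ν : Measure X) [IsFiniteMeasureOnCompacts ν]
    (h : C_c(X × X, ℝ≥0)) : Continuous fun x => ∫ y, (h (x, y) : ℝ) ∂ν := by
  rw [← continuousOn_univ]
  refine continuousOn_integral_of_compact_support
    (h.hasCompactSupport.isCompact.image continuous_snd) (continuous_uncurry_coe h).continuousOn ?_
  intro x y _ hy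
  by_contra hne
  exact hy ⟨(x, y), subset_tsupport _ (by simpa using hne), rfl⟩

theorem lintegral_lintegral_slice (μ ν : Measure X) [IsFiniteMeasureOnCompacts μ]
    [IsFiniteMeasureOnCompacts ν] (h : C_c(X × X, ℝ≥0)) :
    ∫⁻ x, ∫⁻ y, (h (x, y) : ℝ≥0∞) ∂ν ∂μ
      = ENNReal.ofReal (∫ x, ∫ y, (h (x, y) : ℝ) ∂ν ∂μ) := by
  simp_rw [lintegral_slice]
  rw [ofReal_integral_eq_lintegral_ofReal]
  · refine (continuous_integral_slice ν h).integrable_of_hasCompactSupport ?_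
    refine HasCompactSupport.intro (h.hasCompactSupport.isCompact.image continuous_fst)
      fun x hx => ?_
    have : ∀ y, h (x, y) = 0 := by
      intro y
      by_contra hne
      exact hx ⟨(x, y), subset_tsupport _ hne, rfl⟩
    simp [this]
  · exact Eventually.of_forall fun x => integral_nonneg fun y => NNReal.coe_nonneg _

theorem lintegral_slice_eq_iSup (ν : Measure X) [ν.Regular] {f : X × X → ℝ≥0∞}
    (hf : LowerSemicontinuous f) (x : X) :
    ∫⁻ y, f (x, y) ∂ν = ⨆ h : Minorant f, ∫⁻ y, (h.1 (x, y) : ℝ≥0∞) ∂ν := by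
  simp_rw [← iSup_minorant hf]
  refine lintegral_iSup_of_directed_lowerSemicontinuous ν
    (fun h => (lowerSemicontinuous_coe_compactlySupported h.1).comp (by fun_prop)) ?_
  exact fun h₁ h₂ => (directed_minorant f h₁ h₂).imp fun h hh =>
    ⟨fun y => hh.1 (x, y), fun y => hh.2 (x, y)⟩

theorem lowerSemicontinuous_lintegral_slice (ν : Measure X) [ν.Regular] {f : X × X → ℝ≥0∞}
    (hf : LowerSemicontinuous f) : LowerSemicontinuous fun x => ∫⁻ y, f (x, y) ∂ν := by
  simp_rw [lintegral_slice_eq_iSup ν hf, lintegral_slice]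
  exact lowerSemicontinuous_iSup fun h =>
    (ENNReal.continuous_ofReal.comp (continuous_integral_slice ν h.1)).lowerSemicontinuous

theorem lintegral_lintegral_eq_iSup (μ ν : Measure X) [μ.Regular] [ν.Regular]
    {f : X × X → ℝ≥0∞} (hf : LowerSemicontinuous f) :
    ∫⁻ x, ∫⁻ y, f (x, y) ∂ν ∂μ
      = ⨆ h : Minorant f, ∫⁻ x, ∫⁻ y, (h.1 (x, y) : ℝ≥0∞) ∂ν ∂μ := by
  simp_rw [lintegral_slice_eq_iSup ν hf]
  refine lintegral_iSup_of_directed_lowerSemicontinuous μ (fun h => ?_) ?_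
  · simp_rw [lintegral_slice]
    exact (ENNReal.continuous_ofReal.comp (continuous_integral_slice ν h.1)).lowerSemicontinuous
  · exact fun h₁ h₂ => (directed_minorant f h₁ h₂).imp fun h hh =>
      ⟨fun x => lintegral_mono fun y => hh.1 (x, y), fun x => lintegral_mono fun y => hh.2 (x, y)⟩

/-- The left side is a supremum over `C_c` minorants, and for each of these Fubini holds by compact
support. Exchanging the variables turns the inequality into equality. -/
theorem lintegral_lintegral_swap_le_of_lowerSemicontinuous (μ ν : Measure X) [μ.Regular]
    [ν.Regular] {f : X × X → ℝ≥0∞} (hf : LowerSemicontinuous f) :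
    ∫⁻ x, ∫⁻ y, f (x, y) ∂ν ∂μ ≤ ∫⁻ y, ∫⁻ x, f (x, y) ∂μ ∂ν := by
  rw [lintegral_lintegral_eq_iSup μ ν hf]
  refine iSup_le fun h => ?_
  let h' : C_c(X × X, ℝ≥0) := ⟨⟨fun p => h.1 p.swap, by fun_prop⟩,
    h.1.hasCompactSupport.comp_homeomorph (Homeomorph.prodComm X X)⟩
  have e : ∫⁻ y, ∫⁻ x, (h.1 (x, y) : ℝ≥0∞) ∂μ ∂ν
      = ENNReal.ofReal (∫ y, ∫ x, (h.1 (x, y) : ℝ) ∂μ ∂ν) := lintegral_lintegral_slice ν μ h'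
  rw [lintegral_lintegral_slice, integral_integral_swap_of_hasCompactSupport
    (continuous_uncurry_coe h.1) (hasCompactSupport_uncurry_coe h.1), ← e]
  exact lintegral_mono fun y => lintegral_mono fun x => h.2 (x, y)

/-- Tonelli's theorem for lower semicontinuous functions and regular measures, without
`σ`-finiteness. -/
theorem lintegral_lintegral_swap_of_lowerSemicontinuous (μ ν : Measure X) [μ.Regular] [ν.Regular]
    {f : X × X → ℝ≥0∞} (hf : LowerSemicontinuous f) :
    ∫⁻ x, ∫⁻ y, f (x, y) ∂ν ∂μ = ∫⁻ y, ∫⁻ x, f (x, y) ∂μ ∂ν :=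
  le_antisymm (lintegral_lintegral_swap_le_of_lowerSemicontinuous μ ν hf)
    (lintegral_lintegral_swap_le_of_lowerSemicontinuous ν μ (f := fun p => f p.swap)
      (hf.comp continuous_swap))

end Tonelli

/-! ### Vague convergence, semicontinuity and compactness -/

section Vague

variable {X : Type*} [TopologicalSpace X] [T2Space X] [LocallyCompactSpace X]
  [MeasurableSpace X] [BorelSpace X]

instance (μ : RadonMeasure X) : μ.toMeasure.Regular := μ.regular

theorem tendsto_vague_iff {ι : Type*} {m : ι → RadonMeasure X} {F : Filter ι}
    {μ : RadonMeasure X} : Tendsto m F (𝓝 μ) ↔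
      ∀ f : C_c(X, ℝ), Tendsto (fun i => ∫ x, f x ∂(m i).toMeasure) F
        (𝓝 (∫ x, f x ∂μ.toMeasure)) := by
  rw [nhds_induced, tendsto_comap_iff, tendsto_pi_nhds]
  rfl

theorem tendsto_lintegral_of_tendsto_vague {ι : Type*} {m : ι → RadonMeasure X} {F : Filter ι}
    {μ : RadonMeasure X} (h : Tendsto m F (𝓝 μ)) (f : C_c(X, ℝ≥0)) :
    Tendsto (fun i => ∫⁻ x, (f x : ℝ≥0∞) ∂(m i).toMeasure) F
      (𝓝 (∫⁻ x, (f x : ℝ≥0∞) ∂μ.toMeasure)) := by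
  simp_rw [lintegral_coe_eq_ofReal_integral]
  refine (ENNReal.continuous_ofReal.tendsto _).comp ?_
  simpa using tendsto_vague_iff.1 h f.toReal

/-- The integral of a nonnegative lower semicontinuous function is vaguely lower
semicontinuous. -/
theorem lintegral_le_liminf_of_tendsto_vague {ι : Type*} {m : ι → RadonMeasure X} {F : Filter ι}
    [F.NeBot] {μ : RadonMeasure X} (h : Tendsto m F (𝓝 μ)) {f : X → ℝ≥0∞}
    (hf : LowerSemicontinuous f) :
    ∫⁻ x, f x ∂μ.toMeasure ≤ liminf (fun i => ∫⁻ x, f x ∂(m i).toMeasure) F := by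
  rw [lintegral_eq_iSup_minorant _ hf]
  refine iSup_le fun φ => ?_
  rw [← (tendsto_lintegral_of_tendsto_vague h φ.1).liminf_eq]
  exact liminf_le_liminf (Eventually.of_forall fun i => lintegral_mono fun x => φ.2 x)

theorem measure_le_liminf_of_tendsto_vague {ι : Type*} {m : ι → RadonMeasure X} {F : Filter ι}
    [F.NeBot] {μ : RadonMeasure X} (h : Tendsto m F (𝓝 μ)) {U : Set X} (hU : IsOpen U) :
    μ.toMeasure U ≤ liminf (fun i => (m i).toMeasure U) F := by
  have := lintegral_le_liminf_of_tendsto_vague h (f := U.indicator 1)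
    (hU.lowerSemicontinuous_indicator zero_le_one)
  simpa [lintegral_indicator_one hU.measurableSet] using this

/-- A compactly supported continuous function equal to `1` on a given compact set. -/
theorem exists_compactlySupported_eq_one {K : Set X} (hK : IsCompact K) :
    ∃ f : C_c(X, ℝ), (∀ x, 0 ≤ f x) ∧ (∀ x, f x ≤ 1) ∧ ∀ x ∈ K, f x = 1 := by
  obtain ⟨φ, hφ1, -, hφc, hφ⟩ := exists_continuous_one_zero_of_isCompact hK isClosed_empty
    (disjoint_empty K)
  exact ⟨⟨φ, hφc⟩, fun x => (hφ x).1, fun x => (hφ x).2, fun x hx => hφ1 hx⟩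

/-- Vague compactness: an ultrafilter of Radon measures with bounded masses on compact sets
converges vaguely. -/
theorem exists_tendsto_vague_of_ultrafilter {ι : Type*} (m : ι → RadonMeasure X)
    (U : Ultrafilter ι)
    (hb : ∀ K : Set X, IsCompact K → ∃ C : ℝ≥0, ∀ᶠ i in U, (m i).toMeasure K ≤ C) :
    ∃ μ : RadonMeasure X, Tendsto m U (𝓝 μ) := by
  have hint : ∀ (i : ι) (f : C_c(X, ℝ)), Integrable f (m i).toMeasure := fun i f =>
    f.continuous.integrable_of_hasCompactSupport f.hasCompactSupport
  have hlim : ∀ f : C_c(X, ℝ), ∃ a : ℝ, Tendsto (fun i => ∫ x, f x ∂(m i).toMeasure) U (𝓝 a) := by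
    intro f
    obtain ⟨C, hC⟩ := hb _ f.hasCompactSupport
    obtain ⟨D, hD0, hD⟩ : ∃ D : ℝ, 0 ≤ D ∧ ∀ x, ‖f x‖ ≤ D := by
      obtain ⟨D, hD⟩ := f.continuous.bounded_above_of_compact_support f.hasCompactSupport
      exact ⟨max D 0, le_max_right _ _, fun x => (hD x).trans (le_max_left _ _)⟩
    have hmem : ∀ᶠ i in U, (∫ x, f x ∂(m i).toMeasure) ∈ Metric.closedBall (0 : ℝ) (D * C) := by
      filter_upwards [hC] with i hi
      rw [mem_closedBall_zero_iff, ← setIntegral_eq_integral_of_forall_compl_eq_zero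
        (s := tsupport f) (fun x hx => image_eq_zero_of_notMem_tsupport hx)]
      refine (norm_setIntegral_le_of_norm_le_const (lt_of_le_of_lt hi ENNReal.coe_lt_top)
        (fun x _ => hD x)).trans ?_
      gcongr
      exact ENNReal.toReal_le_coe_of_le_coe hi
    obtain ⟨a, -, ha⟩ := (isCompact_closedBall (0 : ℝ) (D * C)).ultrafilter_le_nhds
      (U.map fun i => ∫ x, f x ∂(m i).toMeasure) (le_principal_iff.2 hmem)
    exact ⟨a, ha⟩
  choose Λ hΛ using hlim
  let L : C_c(X, ℝ) →ₚ[ℝ] ℝ := PositiveLinearMap.mk₀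
    { toFun := Λ
      map_add' := fun f g => by
        refine tendsto_nhds_unique (hΛ (f + g)) (((hΛ f).add (hΛ g)).congr fun i => ?_)
        rw [← integral_add (hint i f) (hint i g)]
        rfl
      map_smul' := fun c f => by
        refine tendsto_nhds_unique (hΛ (c • f)) (((hΛ f).const_mul c).congr fun i => ?_)
        rw [← integral_const_mul]
        rfl }
    (fun f hf => ge_of_tendsto' (hΛ f) fun i => integral_nonneg hf)
  refine ⟨⟨RealRMK.rieszMeasure L, inferInstance⟩, tendsto_vague_iff.2 fun f => ?_⟩
  rw [RealRMK.integral_rieszMeasure]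
  exact hΛ f

end Vague

/-! ### Sums, multiples and restrictions of Radon measures -/

section Operations

variable {X : Type*} [TopologicalSpace X] [T2Space X] [LocallyCompactSpace X]
  [MeasurableSpace X] [BorelSpace X]

theorem regular_add (μ ν : Measure X) [μ.Regular] [ν.Regular] : (μ + ν).Regular where
  lt_top_of_isCompact := fun K hK => by
    simpa using ⟨hK.measure_lt_top, hK.measure_lt_top⟩
  outerRegular := fun A _ r hr => by
    have hμA : μ A ≠ ∞ := fun h => by simp [h] at hr
    have hνA : ν A ≠ ∞ := fun h => by simp [h] at hr
    obtain ⟨ε, hε, hlt⟩ : ∃ ε : ℝ≥0∞, ε ≠ 0 ∧ μ A + ν A + (ε + ε) ≤ r := by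
      refine ⟨(r - (μ A + ν A)) / 2, ?_, ?_⟩
      · simpa [tsub_eq_zero_iff_le] using hr
      · rw [ENNReal.add_halves, add_tsub_cancel_of_le]
        exact le_of_lt (by simpa using hr)
    obtain ⟨U, hAU, hU, hμU⟩ := A.exists_isOpen_lt_add (μ := μ) hμA hε
    obtain ⟨V, hAV, hV, hνV⟩ := A.exists_isOpen_lt_add (μ := ν) hνA hε
    refine ⟨U ∩ V, subset_inter hAU hAV, hU.inter hV, ?_⟩
    calc (μ + ν) (U ∩ V) ≤ μ U + ν V := by
          simp only [Measure.coe_add, Pi.add_apply]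
          gcongr
          exacts [inter_subset_left, inter_subset_right]
      _ < (μ A + ε) + (ν A + ε) := ENNReal.add_lt_add hμU hνV
      _ = μ A + ν A + (ε + ε) := by ring
      _ ≤ r := hlt
  innerRegular := fun U hU r hr => by
    let S := {K : Set X // K ⊆ U ∧ IsCompact K}
    have : Nonempty S := ⟨⟨∅, empty_subset _, isCompact_empty⟩⟩
    have hS : ∀ (ρ : Measure X) [ρ.Regular], ρ U = ⨆ K : S, ρ K.1 := fun ρ _ => by
      rw [hU.measure_eq_iSup_isCompact ρ]
      simp_rw [S, iSup_subtype, iSup_and]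
    rw [Measure.add_apply, hS μ, hS ν, ENNReal.iSup_add_iSup, lt_iSup_iff] at hr
    · obtain ⟨K, hK⟩ := hr
      exact ⟨K.1, K.2.1, K.2.2, by simpa using hK⟩
    · intro K L
      refine ⟨⟨K.1 ∪ L.1, union_subset K.2.1 L.2.1, K.2.2.union L.2.2⟩, ?_⟩
      gcongr
      exacts [subset_union_left, subset_union_right]

noncomputable instance : Add (RadonMeasure X) :=
  ⟨fun μ ν => ⟨μ.toMeasure + ν.toMeasure, regular_add _ _⟩⟩

noncomputable instance : SMul ℝ≥0 (RadonMeasure X) :=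
  ⟨fun c μ => ⟨c • μ.toMeasure, inferInstance⟩⟩

@[simp] theorem toMeasure_add (μ ν : RadonMeasure X) :
    (μ + ν).toMeasure = μ.toMeasure + ν.toMeasure := rfl

@[simp] theorem toMeasure_smul (c : ℝ≥0) (μ : RadonMeasure X) :
    (c • μ).toMeasure = c • μ.toMeasure := rfl

@[simp] theorem toMeasure_zero : (0 : RadonMeasure X).toMeasure = 0 := rfl

/-- The restriction of a Radon measure to a set of finite measure. -/
noncomputable def RadonMeasure.restrict (μ : RadonMeasure X) (A : Set X)
    (hA : μ.toMeasure A ≠ ∞) : RadonMeasure X :=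
  ⟨μ.toMeasure.restrict A, Measure.Regular.restrict_of_measure_ne_top hA⟩

@[simp] theorem toMeasure_restrict (μ : RadonMeasure X) (A : Set X) (hA : μ.toMeasure A ≠ ∞) :
    (μ.restrict A hA).toMeasure = μ.toMeasure.restrict A := rfl

end Operations

/-! ### Reduction to a nonnegative kernel by adding a constant -/

section Kernel

variable {X : Type*} [TopologicalSpace X] {κ : X → X → EReal} {c : ℝ≥0}

/-- `-c` is a lower bound of the kernel, and `c = 0` unless `X` is compact. -/
structure IsLowerBound (κ : X → X → EReal) (c : ℝ≥0) : Prop where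
  zero_or_compact : c = 0 ∨ CompactSpace X
  neg_le : ∀ x y, (((-c : ℝ)) : EReal) ≤ κ x y

theorem IsKernel.exists_isLowerBound (hκ : IsKernel κ) : ∃ c, IsLowerBound κ c := by
  by_cases hX : CompactSpace X
  · rcases isEmpty_or_nonempty X with hE | hE
    · exact ⟨0, Or.inl rfl, fun x => hE.elim x⟩
    · obtain ⟨p, -, hp⟩ := hκ.lsc.lowerSemicontinuousOn (univ : Set (X × X)) |>.exists_isMinOn
        univ_nonempty isCompact_univ
      obtain ⟨r, hr⟩ : ∃ r : ℝ, (r : EReal) ≤ κ p.1 p.2 := by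
        induction h : κ p.1 p.2 with
        | bot => exact absurd h (hκ.ne_bot _ _)
        | coe r => exact ⟨r, le_rfl⟩
        | top => exact ⟨0, le_top⟩
      refine ⟨Real.toNNReal (-r), Or.inr hX, fun x y => le_trans ?_ (hr.trans (hp (mem_univ (x, y))))⟩
      rw [EReal.coe_le_coe_iff, Real.coe_toNNReal']
      linarith [le_max_left (-r) 0]
  · exact ⟨0, Or.inl rfl, fun x y => by simpa using hκ.nonneg hX x y⟩

/-- The nonnegative kernel `κ + c`. -/
noncomputable def shift (κ : X → X → EReal) (c : ℝ≥0) (x y : X) : ℝ≥0∞ :=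
  (κ x y + ((c : ℝ) : EReal)).toENNReal

theorem IsKernel.shift_symm (hκ : IsKernel κ) (x y : X) : shift κ c x y = shift κ c y x := by
  rw [shift, shift, hκ.symm]

theorem IsKernel.lowerSemicontinuous_shift (hκ : IsKernel κ) :
    LowerSemicontinuous fun p : X × X => shift κ c p.1 p.2 := by
  have h1 : Continuous fun t : EReal => (t + ((c : ℝ) : EReal)).toENNReal := by
    refine EReal.continuous_toENNReal.comp ?_
    refine continuous_iff_continuousAt.2 fun t => ?_
    exact ContinuousAt.comp (x := t) (g := fun p : EReal × EReal => p.1 + p.2)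
      (f := fun t => (t, ((c : ℝ) : EReal)))
      (EReal.continuousAt_add (by simp) (by simp)) (by fun_prop)
  refine h1.comp_lowerSemicontinuous hκ.lsc fun s t hst => ?_
  exact EReal.toENNReal_le_toENNReal (by gcongr)

theorem IsKernel.lowerSemicontinuous_shift_right (hκ : IsKernel κ) (x : X) :
    LowerSemicontinuous fun y => shift κ c x y :=
  hκ.lowerSemicontinuous_shift.comp (g := fun y => (x, y)) (by fun_prop)

/-- A subtraction-free form of `κ⁺ - κ⁻ = (κ + c) - c`, so it can be integrated in `ℝ≥0∞` without
integrability conditions. -/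
theorem IsLowerBound.toENNReal_add_eq (hc : IsLowerBound κ c) (x y : X) :
    (κ x y).toENNReal + c = shift κ c x y + (-κ x y).toENNReal := by
  have h := hc.neg_le x y
  unfold shift
  induction hk : κ x y with
  | bot => simp [hk] at h
  | top => simp
  | coe r =>
    rw [hk, EReal.coe_le_coe_iff] at h
    rw [← EReal.coe_add, ← EReal.coe_neg, EReal.toENNReal_of_ne_top (EReal.coe_ne_top _),
      EReal.toENNReal_of_ne_top (EReal.coe_ne_top _), EReal.toENNReal_of_ne_top (EReal.coe_ne_top _)]
    simp only [EReal.toReal_coe]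
    rw [← ENNReal.ofReal_coe_nnreal]
    rcases le_total 0 r with h0 | h0
    · rw [ENNReal.ofReal_of_nonpos (p := -r) (by linarith), add_zero,
        ← ENNReal.ofReal_add h0 c.coe_nonneg]
    · rw [ENNReal.ofReal_of_nonpos (p := r) h0, zero_add,
        ← ENNReal.ofReal_add (by linarith) (by linarith)]
      congr 1
      ring

theorem IsLowerBound.toENNReal_neg_le (hc : IsLowerBound κ c) (x y : X) :
    (-κ x y).toENNReal ≤ c := by
  have h : -κ x y ≤ ((c : ℝ) : EReal) := by
    rw [EReal.neg_le]
    exact_mod_cast hc.neg_le x y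
  refine (EReal.toENNReal_le_toENNReal h).trans ?_
  rw [EReal.toENNReal_of_ne_top (EReal.coe_ne_top _)]
  simp

/-- Only the subtracted terms must be finite; `p` and `k` may be infinite, and then both are. -/
theorem coe_sub_coe_eq {p n k d : ℝ≥0∞} (h : p + d = k + n) (hd : d ≠ ∞) (hn : n ≠ ∞) :
    (p : EReal) - n = (k : EReal) - d := by
  lift d to ℝ≥0 using hd
  lift n to ℝ≥0 using hn
  rcases eq_or_ne k ∞ with rfl | hk
  · have hp : p = ∞ := by simpa using h
    rw [hp]
    rfl
  · have hp : p ≠ ∞ := by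
      rintro rfl
      rw [top_add] at h
      exact ENNReal.add_ne_top.2 ⟨hk, ENNReal.coe_ne_top⟩ h.symm
    lift p to ℝ≥0 using hp
    lift k to ℝ≥0 using hk
    have h' : (p : ℝ) + d = k + n := by exact_mod_cast h
    have e : ∀ a b : ℝ≥0, ((a : ℝ≥0∞) : EReal) - ((b : ℝ≥0∞) : EReal) = (((a : ℝ) - b : ℝ) : EReal) :=
      fun a b => rfl
    rw [e, e]
    congr 1
    linarith

variable [MeasurableSpace X]

/-- Either `c = 0`, and `0 * ∞ = 0` covers infinite masses, or `X` is compact and the mass is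
finite. -/
theorem IsLowerBound.mul_ne_top (hc : IsLowerBound κ c) (μ : RadonMeasure X) :
    (c : ℝ≥0∞) * μ.toMeasure univ ≠ ∞ := by
  rcases hc.zero_or_compact with rfl | h
  · simp
  · exact ENNReal.mul_ne_top ENNReal.coe_ne_top (μ.regular.lt_top_of_isCompact isCompact_univ).ne

theorem IsLowerBound.mul_mul_ne_top (hc : IsLowerBound κ c) (μ ν : RadonMeasure X) :
    (c : ℝ≥0∞) * ν.toMeasure univ * μ.toMeasure univ ≠ ∞ := by
  rcases hc.zero_or_compact with rfl | h
  · simp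
  · exact ENNReal.mul_ne_top (hc.mul_ne_top ν) (μ.regular.lt_top_of_isCompact isCompact_univ).ne

/-- The potential of a measure with respect to the shifted kernel. -/
noncomputable def shiftPotential (κ : X → X → EReal) (c : ℝ≥0) (ν : RadonMeasure X) (x : X) :
    ℝ≥0∞ := ∫⁻ y, shift κ c x y ∂ν.toMeasure

/-- The mutual energy with respect to the shifted kernel. -/
noncomputable def shiftEnergy (κ : X → X → EReal) (c : ℝ≥0) (μ ν : RadonMeasure X) : ℝ≥0∞ :=
  ∫⁻ x, shiftPotential κ c ν x ∂μ.toMeasure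

theorem IsLowerBound.lintegral_neg_le (hc : IsLowerBound κ c) (ν : RadonMeasure X) (x : X) :
    ∫⁻ y, (-κ x y).toENNReal ∂ν.toMeasure ≤ c * ν.toMeasure univ :=
  (lintegral_mono fun y => hc.toENNReal_neg_le x y).trans (by simp)

theorem IsLowerBound.lintegral_neg_ne_top (hc : IsLowerBound κ c) (ν : RadonMeasure X) (x : X) :
    ∫⁻ y, (-κ x y).toENNReal ∂ν.toMeasure ≠ ∞ :=
  ne_top_of_le_ne_top (hc.mul_ne_top ν) (hc.lintegral_neg_le ν x)

variable [T2Space X] [LocallyCompactSpace X] [BorelSpace X]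

theorem IsKernel.lintegral_add_eq (hκ : IsKernel κ) (hc : IsLowerBound κ c) (ν : RadonMeasure X)
    (x : X) :
    ∫⁻ y, (κ x y).toENNReal ∂ν.toMeasure + c * ν.toMeasure univ =
      shiftPotential κ c ν x + ∫⁻ y, (-κ x y).toENNReal ∂ν.toMeasure := by
  rw [shiftPotential, ← lintegral_const, ← lintegral_add_right _ measurable_const,
    ← lintegral_add_left (hκ.lowerSemicontinuous_shift_right x).measurable]
  exact lintegral_congr fun y => hc.toENNReal_add_eq x y

theorem IsKernel.lowerSemicontinuous_shiftPotential (hκ : IsKernel κ) (ν : RadonMeasure X) :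
    LowerSemicontinuous (shiftPotential κ c ν) :=
  lowerSemicontinuous_lintegral_slice ν.toMeasure (f := fun p => shift κ c p.1 p.2)
    hκ.lowerSemicontinuous_shift

theorem IsKernel.potential_eq (hκ : IsKernel κ) (hc : IsLowerBound κ c) (ν : RadonMeasure X)
    (x : X) : potential κ ν x =
      (shiftPotential κ c ν x : EReal) - ((c * ν.toMeasure univ : ℝ≥0∞) : EReal) :=
  coe_sub_coe_eq (hκ.lintegral_add_eq hc ν x) (hc.mul_ne_top ν) (hc.lintegral_neg_ne_top ν x)

theorem IsKernel.mutualEnergy_eq (hκ : IsKernel κ) (hc : IsLowerBound κ c)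
    (μ ν : RadonMeasure X) : mutualEnergy κ μ ν =
      (shiftEnergy κ c μ ν : EReal) -
        ((c * ν.toMeasure univ * μ.toMeasure univ : ℝ≥0∞) : EReal) := by
  refine coe_sub_coe_eq ?_ (hc.mul_mul_ne_top μ ν) ?_
  · rw [shiftEnergy, ← lintegral_const, ← lintegral_add_right _ measurable_const,
      ← lintegral_add_left (hκ.lowerSemicontinuous_shiftPotential ν).measurable]
    exact lintegral_congr fun x => hκ.lintegral_add_eq hc ν x
  · refine ne_top_of_le_ne_top (hc.mul_mul_ne_top μ ν) ?_
    exact (lintegral_mono fun x => hc.lintegral_neg_le ν x).trans (by simp)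

theorem IsKernel.shiftEnergy_symm (hκ : IsKernel κ) (μ ν : RadonMeasure X) :
    shiftEnergy κ c μ ν = shiftEnergy κ c ν μ := by
  refine (lintegral_lintegral_swap_of_lowerSemicontinuous μ.toMeasure ν.toMeasure
    (f := fun p => shift κ c p.1 p.2) hκ.lowerSemicontinuous_shift).trans ?_
  simp_rw [hκ.shift_symm]
  rfl

theorem shiftEnergy_add_left (μ₁ μ₂ ν : RadonMeasure X) :
    shiftEnergy κ c (μ₁ + μ₂) ν = shiftEnergy κ c μ₁ ν + shiftEnergy κ c μ₂ ν :=
  lintegral_add_measure _ _ _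

theorem shiftEnergy_smul_left (t : ℝ≥0) (μ ν : RadonMeasure X) :
    shiftEnergy κ c (t • μ) ν = t * shiftEnergy κ c μ ν :=
  lintegral_smul_measure _ _

theorem shiftEnergy_mono {μ₁ μ₂ ν₁ ν₂ : RadonMeasure X} (hμ : μ₁.toMeasure ≤ μ₂.toMeasure)
    (hν : ν₁.toMeasure ≤ ν₂.toMeasure) : shiftEnergy κ c μ₁ ν₁ ≤ shiftEnergy κ c μ₂ ν₂ :=
  lintegral_mono' hμ fun _ => lintegral_mono' hν le_rfl

theorem coe_sub_lt_top_iff {a b : ℝ≥0∞} (hb : b ≠ ∞) : (a : EReal) - b < ⊤ ↔ a < ∞ := by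
  lift b to ℝ≥0 using hb
  rcases eq_or_ne a ∞ with rfl | ha
  · exact ⟨fun h => absurd h (lt_irrefl (⊤ : EReal)), fun h => absurd h (lt_irrefl _)⟩
  · lift a to ℝ≥0 using ha
    exact ⟨fun _ => ENNReal.coe_lt_top, fun _ => EReal.coe_lt_top ((a : ℝ) - b)⟩

theorem IsKernel.mem_finiteEnergy_iff (hκ : IsKernel κ) (hc : IsLowerBound κ c)
    {μ : RadonMeasure X} : μ ∈ FiniteEnergy κ ↔ shiftEnergy κ c μ μ < ∞ := by
  rw [FiniteEnergy, mem_ofPred_eq, energy, hκ.mutualEnergy_eq hc,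
    coe_sub_lt_top_iff (hc.mul_mul_ne_top μ μ)]

end Kernel

/-! ### The energy form: bilinearity, Cauchy–Schwarz, parallelogram law -/

section Form

variable {X : Type*} [TopologicalSpace X] [T2Space X] [LocallyCompactSpace X]
  [MeasurableSpace X] [BorelSpace X] {κ : X → X → EReal} {c : ℝ≥0}
  {μ ν ρ μ₁ μ₂ : RadonMeasure X}

/-- The mutual energy as a real number. -/
noncomputable def form (κ : X → X → EReal) (μ ν : RadonMeasure X) : ℝ :=
  (mutualEnergy κ μ ν).toReal

/-- The square of the strong distance. -/
noncomputable def sqDist (κ : X → X → EReal) (μ ν : RadonMeasure X) : ℝ :=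
  form κ μ μ + form κ ν ν - 2 * form κ μ ν

theorem strongDist_eq (κ : X → X → EReal) (μ ν : RadonMeasure X) :
    strongDist κ μ ν = √(sqDist κ μ ν) := rfl

/-- Positive definiteness bounds twice the mutual energy by the sum of two finite energies. -/
theorem shiftEnergy_lt_top (hκ : IsKernel κ) (hc : IsLowerBound κ c) (hP : PositiveDefinite κ)
    (hμ : μ ∈ FiniteEnergy κ) (hν : ν ∈ FiniteEnergy κ) : shiftEnergy κ c μ ν < ∞ := by
  rw [← coe_sub_lt_top_iff (hc.mul_mul_ne_top μ ν), ← hκ.mutualEnergy_eq hc, lt_top_iff_ne_top]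
  intro h
  have h1 := (hP μ ν).trans_lt (EReal.add_lt_top (ne_of_lt hμ) (ne_of_lt hν))
  rw [h] at h1
  exact absurd h1 (by rw [EReal.mul_top_of_pos (by norm_num)]; exact lt_irrefl _)

theorem coe_form (hκ : IsKernel κ) (hP : PositiveDefinite κ)
    (hμ : μ ∈ FiniteEnergy κ) (hν : ν ∈ FiniteEnergy κ) :
    (form κ μ ν : EReal) = mutualEnergy κ μ ν := by
  obtain ⟨c, hc⟩ := hκ.exists_isLowerBound
  rw [form, hκ.mutualEnergy_eq hc]
  generalize hd : (c : ℝ≥0∞) * ν.toMeasure univ * μ.toMeasure univ = d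
  have hd' : d ≠ ∞ := hd ▸ hc.mul_mul_ne_top μ ν
  have hk := (shiftEnergy_lt_top hκ hc hP hμ hν).ne
  lift d to ℝ≥0 using hd'
  lift shiftEnergy κ c μ ν to ℝ≥0 using hk with k
  rfl

theorem form_eq (hκ : IsKernel κ) (hc : IsLowerBound κ c) (hP : PositiveDefinite κ)
    (hμ : μ ∈ FiniteEnergy κ) (hν : ν ∈ FiniteEnergy κ) :
    form κ μ ν = (shiftEnergy κ c μ ν).toReal
      - (c * ν.toMeasure univ * μ.toMeasure univ).toReal := by
  rw [form, hκ.mutualEnergy_eq hc]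
  generalize hd : (c : ℝ≥0∞) * ν.toMeasure univ * μ.toMeasure univ = d
  have hd' : d ≠ ∞ := hd ▸ hc.mul_mul_ne_top μ ν
  have hk := (shiftEnergy_lt_top hκ hc hP hμ hν).ne
  lift d to ℝ≥0 using hd'
  lift shiftEnergy κ c μ ν to ℝ≥0 using hk with k
  rfl

theorem form_symm (hκ : IsKernel κ) (μ ν : RadonMeasure X) : form κ μ ν = form κ ν μ := by
  obtain ⟨c, hc⟩ := hκ.exists_isLowerBound
  rw [form, form, hκ.mutualEnergy_eq hc, hκ.mutualEnergy_eq hc, hκ.shiftEnergy_symm, mul_right_comm]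

theorem add_mem_finiteEnergy (hκ : IsKernel κ) (hP : PositiveDefinite κ)
    (hμ : μ ∈ FiniteEnergy κ) (hν : ν ∈ FiniteEnergy κ) : μ + ν ∈ FiniteEnergy κ := by
  obtain ⟨c, hc⟩ := hκ.exists_isLowerBound
  rw [hκ.mem_finiteEnergy_iff hc, shiftEnergy_add_left, hκ.shiftEnergy_symm μ,
    hκ.shiftEnergy_symm ν, shiftEnergy_add_left, shiftEnergy_add_left]
  simp only [ENNReal.add_lt_top]
  exact ⟨⟨shiftEnergy_lt_top hκ hc hP hμ hμ, shiftEnergy_lt_top hκ hc hP hν hμ⟩,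
    shiftEnergy_lt_top hκ hc hP hμ hν, shiftEnergy_lt_top hκ hc hP hν hν⟩

theorem smul_mem_finiteEnergy (hκ : IsKernel κ) (t : ℝ≥0) (hμ : μ ∈ FiniteEnergy κ) :
    t • μ ∈ FiniteEnergy κ := by
  obtain ⟨c, hc⟩ := hκ.exists_isLowerBound
  rw [hκ.mem_finiteEnergy_iff hc] at hμ ⊢
  rw [shiftEnergy_smul_left, hκ.shiftEnergy_symm, shiftEnergy_smul_left]
  exact ENNReal.mul_lt_top ENNReal.coe_lt_top (ENNReal.mul_lt_top ENNReal.coe_lt_top hμ)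

theorem zero_mem_finiteEnergy (hκ : IsKernel κ) : (0 : RadonMeasure X) ∈ FiniteEnergy κ := by
  obtain ⟨c, hc⟩ := hκ.exists_isLowerBound
  rw [hκ.mem_finiteEnergy_iff hc]
  simp [shiftEnergy]

/-- Energy is monotone in the measure for the nonnegative kernel `κ + c`, though possibly not for
`κ`. -/
theorem mem_finiteEnergy_of_le (hκ : IsKernel κ) (hμ : μ ∈ FiniteEnergy κ)
    (h : ν.toMeasure ≤ μ.toMeasure) : ν ∈ FiniteEnergy κ := by
  obtain ⟨c, hc⟩ := hκ.exists_isLowerBound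
  rw [hκ.mem_finiteEnergy_iff hc] at hμ ⊢
  exact (shiftEnergy_mono h h).trans_lt hμ

theorem form_zero_left (hκ : IsKernel κ) (hP : PositiveDefinite κ) (hν : ν ∈ FiniteEnergy κ) :
    form κ 0 ν = 0 := by
  obtain ⟨c, hc⟩ := hκ.exists_isLowerBound
  rw [form_eq hκ hc hP (zero_mem_finiteEnergy hκ) hν]
  simp [shiftEnergy]

theorem form_add_left (hκ : IsKernel κ) (hP : PositiveDefinite κ) (hμ₁ : μ₁ ∈ FiniteEnergy κ)
    (hμ₂ : μ₂ ∈ FiniteEnergy κ) (hν : ν ∈ FiniteEnergy κ) :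
    form κ (μ₁ + μ₂) ν = form κ μ₁ ν + form κ μ₂ ν := by
  obtain ⟨c, hc⟩ := hκ.exists_isLowerBound
  rw [form_eq hκ hc hP (add_mem_finiteEnergy hκ hP hμ₁ hμ₂) hν, form_eq hκ hc hP hμ₁ hν,
    form_eq hκ hc hP hμ₂ hν, shiftEnergy_add_left, toMeasure_add, Measure.add_apply, mul_add,
    ENNReal.toReal_add (shiftEnergy_lt_top hκ hc hP hμ₁ hν).ne
      (shiftEnergy_lt_top hκ hc hP hμ₂ hν).ne,
    ENNReal.toReal_add (hc.mul_mul_ne_top _ _) (hc.mul_mul_ne_top _ _)]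
  ring

theorem form_smul_left (hκ : IsKernel κ) (hP : PositiveDefinite κ) (t : ℝ≥0)
    (hμ : μ ∈ FiniteEnergy κ) (hν : ν ∈ FiniteEnergy κ) :
    form κ (t • μ) ν = t * form κ μ ν := by
  obtain ⟨c, hc⟩ := hκ.exists_isLowerBound
  have h : (t • μ.toMeasure) univ = t * μ.toMeasure univ := rfl
  rw [form_eq hκ hc hP (smul_mem_finiteEnergy hκ t hμ) hν, form_eq hκ hc hP hμ hν,
    shiftEnergy_smul_left, toMeasure_smul, h, mul_left_comm, ENNReal.toReal_mul,
    ENNReal.toReal_mul (a := (t : ℝ≥0∞)), ENNReal.coe_toReal]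
  ring

theorem form_add_right (hκ : IsKernel κ) (hP : PositiveDefinite κ) (hμ₁ : μ₁ ∈ FiniteEnergy κ)
    (hμ₂ : μ₂ ∈ FiniteEnergy κ) (hν : ν ∈ FiniteEnergy κ) :
    form κ ν (μ₁ + μ₂) = form κ ν μ₁ + form κ ν μ₂ := by
  simp only [form_symm hκ ν, form_add_left hκ hP hμ₁ hμ₂ hν]

theorem form_smul_right (hκ : IsKernel κ) (hP : PositiveDefinite κ) (t : ℝ≥0)
    (hμ : μ ∈ FiniteEnergy κ) (hν : ν ∈ FiniteEnergy κ) :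
    form κ ν (t • μ) = t * form κ ν μ := by
  simp only [form_symm hκ ν, form_smul_left hκ hP t hμ hν]

theorem sqDist_nonneg (hκ : IsKernel κ) (hP : PositiveDefinite κ)
    (hμ : μ ∈ FiniteEnergy κ) (hν : ν ∈ FiniteEnergy κ) : 0 ≤ sqDist κ μ ν := by
  have h := hP μ ν
  unfold energy at h
  rw [← coe_form hκ hP hμ hν, ← coe_form hκ hP hμ hμ, ← coe_form hκ hP hν hν] at h
  have h' : 2 * form κ μ ν ≤ form κ μ μ + form κ ν ν := by
    rw [show (2 : EReal) = ((2 : ℝ) : EReal) from rfl] at h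
    exact_mod_cast h
  rw [sqDist]
  linarith

theorem sqDist_zero_right (hκ : IsKernel κ) (hP : PositiveDefinite κ)
    (hμ : μ ∈ FiniteEnergy κ) : sqDist κ μ 0 = form κ μ μ := by
  rw [sqDist, form_symm hκ μ 0, form_zero_left hκ hP hμ,
    form_zero_left hκ hP (zero_mem_finiteEnergy hκ)]
  ring

theorem form_self_nonneg (hκ : IsKernel κ) (hP : PositiveDefinite κ)
    (hμ : μ ∈ FiniteEnergy κ) : 0 ≤ form κ μ μ := by
  rw [← sqDist_zero_right hκ hP hμ]
  exact sqDist_nonneg hκ hP hμ (zero_mem_finiteEnergy hκ)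

theorem sqDist_comm (hκ : IsKernel κ) (μ ν : RadonMeasure X) : sqDist κ μ ν = sqDist κ ν μ := by
  rw [sqDist, sqDist, form_symm hκ μ ν]
  ring

theorem sqDist_add_smul_left (hκ : IsKernel κ) (hP : PositiveDefinite κ)
    (hμ : μ ∈ FiniteEnergy κ) (hν : ν ∈ FiniteEnergy κ) (hρ : ρ ∈ FiniteEnergy κ) (t : ℝ≥0) :
    sqDist κ (μ + t • ρ) ν
      = form κ ρ ρ * (t * t) + 2 * (form κ ρ μ - form κ ρ ν) * t + sqDist κ μ ν := by
  have ht := smul_mem_finiteEnergy hκ t hρ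
  have hs := add_mem_finiteEnergy hκ hP hμ ht
  rw [sqDist, form_add_left hκ hP hμ ht hs, form_add_right hκ hP hμ ht hμ,
    form_add_right hκ hP hμ ht ht, form_add_left hκ hP hμ ht hν,
    form_smul_left hκ hP t hρ hμ, form_smul_right hκ hP t hρ hμ, form_smul_left hκ hP t hρ ht,
    form_smul_right hκ hP t hρ hρ, form_smul_left hκ hP t hρ hν, form_symm hκ μ ρ, sqDist]
  ring

/-- The Cauchy–Schwarz inequality for `ρ` and the signed measure `μ - ν`. -/
theorem sq_form_sub_form_le (hκ : IsKernel κ) (hP : PositiveDefinite κ)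
    (hμ : μ ∈ FiniteEnergy κ) (hν : ν ∈ FiniteEnergy κ) (hρ : ρ ∈ FiniteEnergy κ) :
    (form κ ρ μ - form κ ρ ν) ^ 2 ≤ form κ ρ ρ * sqDist κ μ ν := by
  have key : ∀ t : ℝ, 0 ≤ form κ ρ ρ * (t * t) + 2 * (form κ ρ μ - form κ ρ ν) * t
      + sqDist κ μ ν := by
    intro t
    rcases le_total 0 t with h | h
    · lift t to ℝ≥0 using h
      rw [← sqDist_add_smul_left hκ hP hμ hν hρ t]
      exact sqDist_nonneg hκ hP
        (add_mem_finiteEnergy hκ hP hμ (smul_mem_finiteEnergy hκ t hρ)) hν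
    -- For negative `t` the measure `μ + tρ` may be signed, so `sρ` is moved to the side of `ν`,
    -- which leaves the difference unchanged.
    · obtain ⟨s, rfl⟩ : ∃ s : ℝ, t = -s := ⟨-t, by ring⟩
      have hs : 0 ≤ s := by linarith
      lift s to ℝ≥0 using hs
      have h1 := sqDist_nonneg hκ hP
        (add_mem_finiteEnergy hκ hP hν (smul_mem_finiteEnergy hκ s hρ)) hμ
      rw [sqDist_add_smul_left hκ hP hν hμ hρ s, sqDist_comm hκ ν μ] at h1
      linarith
  have hd := discrim_le_zero key
  rw [discrim] at hd
  linarith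

theorem sq_form_le (hκ : IsKernel κ) (hP : PositiveDefinite κ)
    (hμ : μ ∈ FiniteEnergy κ) (hρ : ρ ∈ FiniteEnergy κ) :
    form κ ρ μ ^ 2 ≤ form κ ρ ρ * form κ μ μ := by
  have h := sq_form_sub_form_le hκ hP hμ (zero_mem_finiteEnergy hκ) hρ
  rwa [form_symm hκ ρ 0, form_zero_left hκ hP hρ, sub_zero, sqDist_zero_right hκ hP hμ] at h

/-- The parallelogram law. -/
theorem sqDist_eq_midpoint (hκ : IsKernel κ) (hP : PositiveDefinite κ)
    (hμ : μ ∈ FiniteEnergy κ) (hν : ν ∈ FiniteEnergy κ) :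
    sqDist κ μ ν = 2 * form κ μ μ + 2 * form κ ν ν
      - 4 * form κ ((1 / 2 : ℝ≥0) • (μ + ν)) ((1 / 2 : ℝ≥0) • (μ + ν)) := by
  have hs := add_mem_finiteEnergy hκ hP hμ hν
  rw [form_smul_left hκ hP _ hs (smul_mem_finiteEnergy hκ _ hs), form_smul_right hκ hP _ hs hs,
    form_add_left hκ hP hμ hν hs, form_add_right hκ hP hμ hν hμ, form_add_right hκ hP hμ hν hν,
    sqDist, form_symm hκ ν μ]
  push_cast
  ring

theorem eq_of_sqDist_eq_zero (hE : EnergyPrinciple κ) (hμ : μ ∈ FiniteEnergy κ)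
    (hν : ν ∈ FiniteEnergy κ) (h : sqDist κ μ ν = 0) : μ = ν :=
  hE μ hμ ν hν (by rw [strongDist_eq, h, Real.sqrt_zero])

end Form

/-! ### Strong convergence and strong Cauchy nets -/

section Convergence

variable {X : Type*} [TopologicalSpace X] [T2Space X] [LocallyCompactSpace X]
  [MeasurableSpace X] [BorelSpace X] {κ : X → X → EReal} {ι : Type*} {m : ι → RadonMeasure X}
  {F : Filter ι} {μ ν ρ : RadonMeasure X}

theorem tendsto_sqDist_of_strongTendsto (hκ : IsKernel κ) (hP : PositiveDefinite κ)
    (h : StrongTendsto κ m F μ) : Tendsto (fun i => sqDist κ (m i) μ) F (𝓝 0) := by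
  have h2 := h.2.2.pow 2
  rw [zero_pow two_ne_zero] at h2
  refine h2.congr' ?_
  filter_upwards [h.1] with i hi
  rw [strongDist_eq, Real.sq_sqrt (sqDist_nonneg hκ hP hi h.2.1)]

theorem tendsto_form_of_strongTendsto (hκ : IsKernel κ) (hP : PositiveDefinite κ)
    (h : StrongTendsto κ m F μ) (hρ : ρ ∈ FiniteEnergy κ) :
    Tendsto (fun i => form κ ρ (m i)) F (𝓝 (form κ ρ μ)) := by
  have h1 : Tendsto (fun i => √(form κ ρ ρ * sqDist κ (m i) μ)) F (𝓝 0) := by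
    have := ((tendsto_sqDist_of_strongTendsto hκ hP h).const_mul (form κ ρ ρ)).sqrt
    simpa using this
  rw [tendsto_iff_dist_tendsto_zero]
  refine squeeze_zero' (Eventually.of_forall fun i => dist_nonneg) ?_ h1
  filter_upwards [h.1] with i hi
  rw [Real.dist_eq]
  exact Real.abs_le_sqrt (sq_form_sub_form_le hκ hP hi h.2.1 hρ)

theorem tendsto_form_self_of_strongTendsto (hκ : IsKernel κ) (hP : PositiveDefinite κ)
    (h : StrongTendsto κ m F μ) :
    Tendsto (fun i => form κ (m i) (m i)) F (𝓝 (form κ μ μ)) := by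
  have h1 := (tendsto_sqDist_of_strongTendsto hκ hP h).add
    ((tendsto_form_of_strongTendsto hκ hP h h.2.1).const_mul 2) |>.sub_const (form κ μ μ)
  have e : 0 + 2 * form κ μ μ - form κ μ μ = form κ μ μ := by ring
  rw [e] at h1
  refine h1.congr fun i => ?_
  rw [sqDist, form_symm hκ μ (m i)]
  ring

theorem strongTendsto_unique [F.NeBot] (hκ : IsKernel κ) (hP : PositiveDefinite κ)
    (hE : EnergyPrinciple κ) (hμ : StrongTendsto κ m F μ) (hν : StrongTendsto κ m F ν) :
    μ = ν := by
  have h : ∀ ρ ∈ FiniteEnergy κ, form κ ρ μ = form κ ρ ν := fun ρ hρ =>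
    tendsto_nhds_unique (tendsto_form_of_strongTendsto hκ hP hμ hρ)
      (tendsto_form_of_strongTendsto hκ hP hν hρ)
  refine eq_of_sqDist_eq_zero hE hμ.2.1 hν.2.1 ?_
  have h1 := h μ hμ.2.1
  have h2 := h ν hν.2.1
  rw [form_symm hκ ν μ] at h2
  rw [sqDist]
  linarith

/-- The Cauchy condition for the strong pseudometric, along a filter. -/
def StrongCauchy (κ : X → X → EReal) (m : ι → RadonMeasure X) (F : Filter ι) : Prop :=
  ∀ ε : ℝ, 0 < ε → ∃ S ∈ F, ∀ i ∈ S, ∀ j ∈ S, sqDist κ (m i) (m j) < ε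

/-- A strong Cauchy net that is bounded on compact sets converges strongly and vaguely. -/
theorem exists_tendsto_of_strongCauchy_of_bounded [F.NeBot] (hκ : IsKernel κ)
    (hperf : IsPerfect κ) (hm : ∀ᶠ i in F, m i ∈ FiniteEnergy κ) (hC : StrongCauchy κ m F)
    (hb : ∀ K : Set X, IsCompact K → ∃ C : ℝ≥0, ∀ᶠ i in F, (m i).toMeasure K ≤ C) :
    ∃ μ, StrongTendsto κ m F μ ∧ Tendsto m F (𝓝 μ) := by
  have hstrong : ∀ μ, ClusterPt μ (F.map m) → StrongTendsto κ m F μ := by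
    intro μ hμ
    refine hperf.consistent (F.map m) inferInstance hm ?_ μ hμ
    intro ε hε
    obtain ⟨S, hS, h⟩ := hC (ε ^ 2) (by positivity)
    refine ⟨m '' S, image_mem_map hS, ?_⟩
    rintro _ ⟨i, hi, rfl⟩ _ ⟨j, hj, rfl⟩
    rw [strongDist_eq, Real.sqrt_lt' hε]
    exact h i hi j hj
  have hcl : ∀ U : Ultrafilter ι, ↑U ≤ F → ∃ μ, Tendsto m U (𝓝 μ) := fun U hU =>
    exists_tendsto_vague_of_ultrafilter m U fun K hK =>
      (hb K hK).imp fun C h => h.filter_mono hU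
  have hclu : ∀ (U : Ultrafilter ι) (μ : RadonMeasure X), ↑U ≤ F → Tendsto m U (𝓝 μ) →
      StrongTendsto κ m F μ := fun U μ hU h =>
    hstrong μ ((ClusterPt.of_le_nhds h).mono (map_mono hU))
  obtain ⟨μ, hμ⟩ := hcl (Ultrafilter.of F) (Ultrafilter.of_le F)
  have hμs := hclu _ μ (Ultrafilter.of_le F) hμ
  -- Every ultrafilter finer than `F` has a vague limit; by consistency this is also a strong limit
  -- along `F`, hence equal to `μ`.
  refine ⟨μ, hμs, (tendsto_iff_ultrafilter m F _).2 fun U hU => ?_⟩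
  obtain ⟨ν, hν⟩ := hcl U hU
  rwa [strongTendsto_unique hκ hperf.posDef hperf.energyPrinciple hμs (hclu U ν hU hν)]

end Convergence

/-! ### Strong boundedness implies vague boundedness -/

section Boundedness

variable {X : Type*} [TopologicalSpace X] [T2Space X] [LocallyCompactSpace X]
  [MeasurableSpace X] [BorelSpace X] {κ : X → X → EReal} {c : ℝ≥0} {ι : Type*}
  {m : ι → RadonMeasure X} {F : Filter ι} {μ ν ρ : RadonMeasure X} {K : Set X}

theorem measure_ne_top_of_isCompact (μ : RadonMeasure X) (hK : IsCompact K) :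
    μ.toMeasure K ≠ ∞ := hK.measure_lt_top.ne

theorem measure_univ_eq_of_compl (h : μ.toMeasure Kᶜ = 0) :
    μ.toMeasure univ = μ.toMeasure K :=
  (measure_eq_measure_of_null_sdiff (subset_univ K) (by rwa [← compl_eq_univ_sdiff])).symm

theorem measure_univ_ne_top_of_compl (hK : IsCompact K) (h : μ.toMeasure Kᶜ = 0) :
    μ.toMeasure univ ≠ ∞ := by
  rw [measure_univ_eq_of_compl h]
  exact measure_ne_top_of_isCompact μ hK

theorem integral_eq_of_eq_one (f : C_c(X, ℝ)) (hf : ∀ x ∈ K, f x = 1)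
    (h : μ.toMeasure Kᶜ = 0) : ∫ x, f x ∂μ.toMeasure = (μ.toMeasure univ).toReal := by
  have : ∀ᵐ x ∂μ.toMeasure, f x = 1 := by
    rw [ae_iff]
    exact measure_mono_null (fun x hx hxK => hx (hf x hxK)) h
  rw [integral_congr_ae this]
  simp [Measure.real]

/-- The total mass is vaguely continuous on measures carried by a fixed compact set. -/
theorem compl_eq_zero_and_univ_eq_of_tendsto_vague [F.NeBot] (hK : IsCompact K)
    (h : Tendsto m F (𝓝 μ)) (hm : ∀ i, (m i).toMeasure Kᶜ = 0) {a : ℝ≥0∞}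
    (ha : ∀ i, (m i).toMeasure univ = a) : μ.toMeasure Kᶜ = 0 ∧ μ.toMeasure univ = a := by
  have h0 : μ.toMeasure Kᶜ = 0 := by
    have := measure_le_liminf_of_tendsto_vague h hK.isClosed.isOpen_compl
    simpa [hm] using this
  refine ⟨h0, ?_⟩
  obtain ⟨f, -, -, hf⟩ := exists_compactlySupported_eq_one hK
  have h1 := tendsto_vague_iff.1 h f
  simp only [integral_eq_of_eq_one f hf (hm _), integral_eq_of_eq_one f hf h0, ha] at h1
  have h2 := tendsto_nhds_unique h1 tendsto_const_nhds
  obtain ⟨i⟩ := F.nonempty_of_neBot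
  have ha' : a ≠ ∞ := ha i ▸ measure_univ_ne_top_of_compl hK (hm i)
  exact (ENNReal.toReal_eq_toReal_iff' (measure_univ_ne_top_of_compl hK h0) ha').1 h2

/-- A nonzero measure carried by a compact set can be rescaled to a unit measure. -/
theorem smul_inv_univ (hK : IsCompact K) (h : μ.toMeasure Kᶜ = 0) (h0 : μ.toMeasure univ ≠ 0) :
    (((μ.toMeasure univ).toNNReal⁻¹ • μ).toMeasure univ = 1) ∧
      ((μ.toMeasure univ).toNNReal⁻¹ • μ).toMeasure Kᶜ = 0 := by
  have ht := measure_univ_ne_top_of_compl hK h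
  constructor
  · change (((μ.toMeasure univ).toNNReal⁻¹ : ℝ≥0) : ℝ≥0∞) * μ.toMeasure univ = 1
    rw [ENNReal.coe_inv (ENNReal.toNNReal_ne_zero.2 ⟨h0, ht⟩), ENNReal.coe_toNNReal ht,
      ENNReal.inv_mul_cancel h0 ht]
  · change (((μ.toMeasure univ).toNNReal⁻¹ : ℝ≥0) : ℝ≥0∞) * μ.toMeasure Kᶜ = 0
    rw [h, mul_zero]

/-- If `κ ≥ 0`, restriction decreases energy and `L = K` works. A kernel with negative values could
break this, but then `X` is compact and `L = X` restricts nothing. -/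
theorem exists_compact_form_restrict_le (hκ : IsKernel κ) (hP : PositiveDefinite κ)
    (hK : IsCompact K) : ∃ L, K ⊆ L ∧ ∃ hL : IsCompact L, ∀ μ ∈ FiniteEnergy κ,
      form κ (μ.restrict L (measure_ne_top_of_isCompact μ hL))
        (μ.restrict L (measure_ne_top_of_isCompact μ hL)) ≤ form κ μ μ := by
  obtain ⟨c, hc⟩ := hκ.exists_isLowerBound
  rcases hc.zero_or_compact with rfl | h
  · refine ⟨K, Subset.rfl, hK, fun μ hμ => ?_⟩
    have hle : (μ.restrict K (measure_ne_top_of_isCompact μ hK)).toMeasure ≤ μ.toMeasure :=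
      Measure.restrict_le_self
    have hr := mem_finiteEnergy_of_le hκ hμ hle
    rw [form_eq hκ hc hP hr hr, form_eq hκ hc hP hμ hμ]
    simp only [ENNReal.coe_zero, zero_mul, ENNReal.toReal_zero, sub_zero]
    exact ENNReal.toReal_mono (shiftEnergy_lt_top hκ hc hP hμ hμ).ne (shiftEnergy_mono hle hle)
  · refine ⟨univ, subset_univ _, isCompact_univ, fun μ hμ => le_of_eq ?_⟩
    congr 1 <;> exact RadonMeasure.ext (by simp)

/-- Strongly bounded sets of measures are bounded on compact sets. -/
theorem exists_measure_sq_le (hκ : IsKernel κ) (hperf : IsPerfect κ) (hK : IsCompact K) :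
    ∃ C : ℝ, ∀ μ ∈ FiniteEnergy κ, (μ.toMeasure K).toReal ^ 2 ≤ C * form κ μ μ := by
  have hP := hperf.posDef
  obtain ⟨L, hKL, hL, hform⟩ := exists_compact_form_restrict_le hκ hP hK
  by_contra! hcon
  -- A counterexample to the constant `n + 1`, restricted to `L` and normalized, is a unit measure
  -- of energy at most `1 / (n + 1)`.
  have hex : ∀ n : ℕ, ∃ ρ ∈ FiniteEnergy κ, form κ ρ ρ ≤ 1 / ((n : ℝ) + 1) ∧
      ρ.toMeasure univ = 1 ∧ ρ.toMeasure Lᶜ = 0 := by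
    intro n
    obtain ⟨μ, hμ, hlt⟩ := hcon ((n : ℝ) + 1)
    set σ := μ.restrict L (measure_ne_top_of_isCompact μ hL) with hσ
    have hσE : σ ∈ FiniteEnergy κ := mem_finiteEnergy_of_le hκ hμ Measure.restrict_le_self
    have hσL : σ.toMeasure Lᶜ = 0 := by
      rw [hσ, toMeasure_restrict, Measure.restrict_apply hL.measurableSet.compl]
      simp
    have hσu : σ.toMeasure univ = μ.toMeasure L := by simp [hσ]
    have hmono : (μ.toMeasure K).toReal ≤ (μ.toMeasure L).toReal :=
      ENNReal.toReal_mono (measure_ne_top_of_isCompact μ hL) (measure_mono hKL)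
    have hfn := form_self_nonneg hκ hP hμ
    have hn : (0 : ℝ) < n + 1 := by positivity
    have hsq : (μ.toMeasure K).toReal ^ 2 ≤ (σ.toMeasure univ).toReal ^ 2 := by
      rw [hσu]
      gcongr
    have hpos : 0 < (σ.toMeasure univ).toReal ^ 2 :=
      lt_of_lt_of_le (lt_of_le_of_lt (by positivity) hlt) hsq
    have h0 : σ.toMeasure univ ≠ 0 := by
      intro h
      simp [h] at hpos
    refine ⟨(σ.toMeasure univ).toNNReal⁻¹ • σ, smul_mem_finiteEnergy hκ _ hσE, ?_,
      smul_inv_univ hL hσL h0⟩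
    rw [form_smul_left hκ hP _ hσE (smul_mem_finiteEnergy hκ _ hσE),
      form_smul_right hκ hP _ hσE hσE, NNReal.coe_inv, ENNReal.coe_toNNReal_eq_toReal,
      ← mul_assoc, ← mul_inv, ← sq, inv_mul_le_iff₀ hpos, mul_one_div, le_div_iff₀ hn, mul_comm]
    have hle := hform μ hμ
    exact (mul_le_mul_of_nonneg_left hle hn.le).trans (hlt.le.trans hsq)
  choose ρ hρE hρf hρu hρL using hex
  have hlim : Tendsto (fun n : ℕ => 1 / ((n : ℝ) + 1)) atTop (𝓝 0) :=
    tendsto_one_div_add_atTop_nhds_zero_nat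
  obtain ⟨σ, hσs, hσv⟩ := exists_tendsto_of_strongCauchy_of_bounded (F := atTop) (m := ρ) hκ hperf
    (Eventually.of_forall hρE) (by
      intro ε hε
      refine ⟨{n | 1 / ((n : ℝ) + 1) < ε / 4},
        hlim.eventually (gt_mem_nhds (by positivity)), fun i hi j hj => ?_⟩
      rw [sqDist_eq_midpoint hκ hP (hρE i) (hρE j)]
      have h1 := form_self_nonneg hκ hP (smul_mem_finiteEnergy hκ (1 / 2)
        (add_mem_finiteEnergy hκ hP (hρE i) (hρE j)))
      have h2 := (hρf i).trans_lt hi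
      have h3 := (hρf j).trans_lt hj
      linarith)
    (fun K _ => ⟨1, Eventually.of_forall fun n => by
      rw [ENNReal.coe_one, ← hρu n]
      exact measure_mono (subset_univ _)⟩)
  -- The contradiction: the strong limit has zero energy, so it is `0` by the energy principle,
  -- while vague convergence on the fixed compact set `L` preserves mass `1`.
  have hσ0 : form κ σ σ = 0 :=
    le_antisymm (le_of_tendsto_of_tendsto' (tendsto_form_self_of_strongTendsto hκ hP hσs) hlim hρf)
      (form_self_nonneg hκ hP hσs.2.1)
  have hz : σ = 0 := eq_of_sqDist_eq_zero hperf.energyPrinciple hσs.2.1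
    (zero_mem_finiteEnergy hκ) (by rw [sqDist_zero_right hκ hP hσs.2.1, hσ0])
  have := (compl_eq_zero_and_univ_eq_of_tendsto_vague hL hσv hρL hρu).2
  simp [hz] at this

/-- A strongly bounded strong Cauchy net converges strongly and vaguely. -/
theorem exists_tendsto_of_strongCauchy [F.NeBot] (hκ : IsKernel κ) (hperf : IsPerfect κ)
    (hm : ∀ i, m i ∈ FiniteEnergy κ) (hC : StrongCauchy κ m F) {M : ℝ}
    (hM : ∀ i, form κ (m i) (m i) ≤ M) :
    ∃ μ, StrongTendsto κ m F μ ∧ Tendsto m F (𝓝 μ) := by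
  refine exists_tendsto_of_strongCauchy_of_bounded hκ hperf (Eventually.of_forall hm) hC
    fun K hK => ?_
  obtain ⟨C, hC⟩ := exists_measure_sq_le hκ hperf hK
  refine ⟨Real.toNNReal (√(|C| * M)), Eventually.of_forall fun i => ?_⟩
  have hM0 : 0 ≤ form κ (m i) (m i) := form_self_nonneg hκ hperf.posDef (hm i)
  have h1 : (((m i).toMeasure K).toReal) ^ 2 ≤ |C| * M := by
    refine (hC _ (hm i)).trans ?_
    gcongr
    exacts [le_abs_self C, hM i]
  rw [← ENNReal.ofReal_toReal (measure_ne_top_of_isCompact (m i) hK)]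
  exact ENNReal.ofReal_le_ofReal (Real.le_sqrt_of_sq_le h1)

/-- A net in `𝓔⁺` whose midpoints have energy at least `a`, with energies approaching `a`. -/
theorem strongCauchy_of_midpoint (hκ : IsKernel κ) (hP : PositiveDefinite κ)
    (hm : ∀ i, m i ∈ FiniteEnergy κ)
    (h : ∀ ε : ℝ, 0 < ε → ∃ a : ℝ, ∃ S ∈ F, (∀ i ∈ S, form κ (m i) (m i) < a + ε) ∧
      ∀ i ∈ S, ∀ j ∈ S, a ≤ form κ ((1 / 2 : ℝ≥0) • (m i + m j)) ((1 / 2 : ℝ≥0) • (m i + m j))) :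
    StrongCauchy κ m F := by
  intro ε hε
  -- The parallelogram law bounds the squared distance by `2(a + ε/4) + 2(a + ε/4) - 4a = ε`.
  obtain ⟨a, S, hS, h1, h2⟩ := h (ε / 4) (by positivity)
  refine ⟨S, hS, fun i hi j hj => ?_⟩
  rw [sqDist_eq_midpoint hκ hP (hm i) (hm j)]
  linarith [h1 i hi, h1 j hj, h2 i hi j hj]

end Boundedness

/-! ### The class `Γ_A⁺`: dual description, convexity, uniqueness of minimizers -/

section Gamma

variable {X : Type*} [TopologicalSpace X] [T2Space X] [LocallyCompactSpace X]
  [MeasurableSpace X] [BorelSpace X] {κ : X → X → EReal} {c : ℝ≥0}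
  {μ ν γ : RadonMeasure X} {A K : Set X}

theorem le_coe_sub_coe_iff {a d : ℝ≥0∞} (hd : d ≠ ∞) :
    (1 : EReal) ≤ (a : EReal) - d ↔ 1 + d ≤ a := by
  rw [EReal.le_sub_iff_add_le (Or.inl (EReal.coe_ennreal_ne_bot d))
    (Or.inl (by simpa using hd)), ← EReal.coe_ennreal_one, ← EReal.coe_ennreal_add,
    EReal.coe_ennreal_le_coe_ennreal_iff]

theorem one_le_potential_iff (hκ : IsKernel κ) (hc : IsLowerBound κ c) (x : X) :
    1 ≤ potential κ ν x ↔ 1 + c * ν.toMeasure univ ≤ shiftPotential κ c ν x := by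
  rw [hκ.potential_eq hc, le_coe_sub_coe_iff (hc.mul_ne_top ν)]

theorem measurableSet_one_le_potential (hκ : IsKernel κ) (ν : RadonMeasure X) :
    MeasurableSet {x | 1 ≤ potential κ ν x} := by
  obtain ⟨c, hc⟩ := hκ.exists_isLowerBound
  simp_rw [one_le_potential_iff hκ hc]
  exact measurableSet_le measurable_const (hκ.lowerSemicontinuous_shiftPotential ν).measurable

theorem smul_restrict_concentratedOn {B : Set X} (hKA : K ⊆ A) (h : μ.toMeasure Kᶜ = 0)
    (hB : MeasurableSet B) (hBt : μ.toMeasure B ≠ ∞) (t : ℝ≥0) :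
    ConcentratedOn (t • μ.restrict B hBt) (A ∩ B) := by
  intro L _
  have h1 : μ.toMeasure.restrict B (A ∩ B)ᶜ = 0 := by
    rw [Measure.restrict_apply₀' hB.nullMeasurableSet]
    refine measure_mono_null ?_ h
    rintro x ⟨hx, hxB⟩ hxK
    exact hx ⟨hKA hxK, hxB⟩
  have h2 : (t • μ.toMeasure.restrict B) (A ∩ B)ᶜ = 0 := by
    rw [Measure.smul_apply, h1, smul_zero]
  exact measure_mono_null (fun x hx => hx.2) h2

theorem minEnergy_ne_top_iff {κ : X → X → EReal} {A : Set X} :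
    minEnergy κ A ≠ ∞ ↔ ∃ μ : RadonMeasure X,
      μ ∈ FiniteEnergy κ ∧ ConcentratedOn μ A ∧ μ.toMeasure univ = 1 := by
  rw [← lt_top_iff_ne_top, minEnergy]
  simp only [iInf_lt_iff, exists_prop, mem_ofPred_eq]
  constructor
  · rintro ⟨μ, hμ, -⟩
    exact ⟨μ, hμ⟩
  · rintro ⟨μ, hμ⟩
    refine ⟨μ, hμ, ?_⟩
    rw [lt_top_iff_ne_top]
    exact EReal.toENNReal_ne_top_iff.2 hμ.1.ne

/-- A measure concentrated on `A` of positive mass charges a compact subset of `A`. -/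
theorem exists_isCompact_subset_of_concentratedOn (h : ConcentratedOn μ A)
    (h0 : μ.toMeasure univ ≠ 0) : ∃ K ⊆ A, IsCompact K ∧ μ.toMeasure K ≠ 0 := by
  obtain ⟨L, hL, hLμ⟩ := Measure.Regular.exists_isCompact_not_null.2
    (fun h => h0 (by rw [h]; rfl) : μ.toMeasure ≠ 0)
  -- `A` need not be measurable; removing a measurable null hull of `L \ A` leaves a measurable
  -- subset of `A` of full measure in `L`.
  set T := L ∩ (toMeasurable μ.toMeasure (L \ A))ᶜ with hT
  have hTm : MeasurableSet T :=
    hL.measurableSet.inter (measurableSet_toMeasurable _ _).compl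
  have hTA : T ⊆ A := by
    rintro x ⟨hxL, hx⟩
    by_contra hxA
    exact hx (subset_toMeasurable _ _ ⟨hxL, hxA⟩)
  have hTμ : μ.toMeasure T = μ.toMeasure L := by
    refine measure_inter_conull ?_
    rw [compl_compl, measure_toMeasurable]
    exact h L hL
  have hTt : μ.toMeasure T ≠ ∞ := hTμ ▸ measure_ne_top_of_isCompact μ hL
  obtain ⟨K, hKT, hK, hKμ⟩ := hTm.exists_lt_isCompact_of_ne_top hTt
    (hTμ ▸ pos_iff_ne_zero.2 hLμ)
  exact ⟨K, hKT.trans hTA, hK, hKμ.ne'⟩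

/-- "Nearly everywhere on `A`" in terms of measures of finite energy carried by compact subsets
of `A`. -/
theorem mem_Gam_iff_ae (hκ : IsKernel κ) : ν ∈ Gam κ A ↔ ν ∈ FiniteEnergy κ ∧
    ∀ K ⊆ A, IsCompact K → ∀ μ ∈ FiniteEnergy κ, μ.toMeasure Kᶜ = 0 →
      ∀ᵐ x ∂μ.toMeasure, 1 ≤ potential κ ν x := by
  set N := {x | ¬ 1 ≤ potential κ ν x} with hN
  have hNm : MeasurableSet N := (measurableSet_one_le_potential hκ ν).compl
  refine and_congr_right fun _ => ?_
  have hset : {x | x ∈ A ∧ ¬ 1 ≤ potential κ ν x} = A ∩ N := rfl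
  rw [NearlyEverywhereOn, innerCapacity, ENNReal.inv_eq_zero, hset]
  constructor
  · intro hw K hKA hK μ hμ h
    rw [ae_iff]
    by_contra hne
    have ht : μ.toMeasure N ≠ ∞ :=
      ne_top_of_le_ne_top (measure_univ_ne_top_of_compl hK h) (measure_mono (subset_univ _))
    -- If `μ` charged the failure set `N`, its normalized restriction to `N` would be an admissible
    -- unit measure for `A ∩ N`, contradicting zero capacity.
    refine minEnergy_ne_top_iff.2 ?_ hw
    refine ⟨((μ.restrict N ht).toMeasure univ).toNNReal⁻¹ • μ.restrict N ht,
      smul_mem_finiteEnergy hκ _ (mem_finiteEnergy_of_le hκ hμ Measure.restrict_le_self),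
      smul_restrict_concentratedOn hKA h hNm ht _, (smul_inv_univ hK ?_ ?_).1⟩
    · exact nonpos_iff_eq_zero.1 ((Measure.restrict_apply_le N Kᶜ).trans h.le)
    · rw [toMeasure_restrict, Measure.restrict_apply_univ]
      exact hne
  · intro hall
    by_contra hne
    obtain ⟨μ, hμ, hcon, hu⟩ := minEnergy_ne_top_iff.1 hne
    obtain ⟨K, hKA, hK, hKμ⟩ := exists_isCompact_subset_of_concentratedOn hcon (by simp [hu])
    have hae := hall K (hKA.trans inter_subset_left) hK
      (μ.restrict K (measure_ne_top_of_isCompact μ hK))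
      (mem_finiteEnergy_of_le hκ hμ Measure.restrict_le_self) (by
        rw [toMeasure_restrict, Measure.restrict_apply hK.measurableSet.compl]
        simp)
    rw [ae_iff, toMeasure_restrict, Measure.restrict_apply hNm,
      inter_eq_right.2 (hKA.trans inter_subset_right)] at hae
    exact hKμ hae

theorem univ_le_form_iff (hκ : IsKernel κ) (hc : IsLowerBound κ c) (hP : PositiveDefinite κ)
    (hμ : μ ∈ FiniteEnergy κ) (hν : ν ∈ FiniteEnergy κ) (ht : μ.toMeasure univ ≠ ∞) :
    (μ.toMeasure univ).toReal ≤ form κ μ ν ↔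
      (1 + c * ν.toMeasure univ) * μ.toMeasure univ ≤ shiftEnergy κ c μ ν := by
  have hk := (shiftEnergy_lt_top hκ hc hP hμ hν).ne
  have hm := hc.mul_mul_ne_top μ ν
  rw [form_eq hκ hc hP hμ hν, le_sub_iff_add_le, ← ENNReal.toReal_add ht hm,
    ENNReal.toReal_le_toReal (ENNReal.add_ne_top.2 ⟨ht, hm⟩) hk, add_mul, one_mul]

/-- The class `Γ_A⁺` in terms of mutual energies. -/
theorem mem_Gam_iff (hκ : IsKernel κ) (hP : PositiveDefinite κ) :
    ν ∈ Gam κ A ↔ ν ∈ FiniteEnergy κ ∧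
      ∀ K ⊆ A, IsCompact K → ∀ μ ∈ FiniteEnergy κ, μ.toMeasure Kᶜ = 0 →
        (μ.toMeasure univ).toReal ≤ form κ μ ν := by
  obtain ⟨c, hc⟩ := hκ.exists_isLowerBound
  rw [mem_Gam_iff_ae hκ]
  refine and_congr_right fun hν => ⟨fun h K hKA hK μ hμ hμK => ?_, fun h K hKA hK μ hμ hμK => ?_⟩
  · rw [univ_le_form_iff hκ hc hP hμ hν (measure_univ_ne_top_of_compl hK hμK), ← lintegral_const]
    refine lintegral_mono_ae ?_
    filter_upwards [h K hKA hK μ hμ hμK] with x hx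
    exact (one_le_potential_iff hκ hc x).1 hx
  -- Testing with the restriction of `μ` to `N` gives an integrated inequality opposite to the
  -- strict pointwise one on `N`, so `N` is `μ`-null.
  · set N := {x | ¬ 1 ≤ potential κ ν x} with hN
    have hNm : MeasurableSet N := (measurableSet_one_le_potential hκ ν).compl
    have ht : μ.toMeasure N ≠ ∞ :=
      ne_top_of_le_ne_top (measure_univ_ne_top_of_compl hK hμK) (measure_mono (subset_univ _))
    have hr := mem_finiteEnergy_of_le (ν := μ.restrict N ht) hκ hμ Measure.restrict_le_self
    have h1 := h K hKA hK (μ.restrict N ht) hr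
      (nonpos_iff_eq_zero.1 ((Measure.restrict_apply_le N Kᶜ).trans hμK.le))
    rw [univ_le_form_iff hκ hc hP hr hν (by simpa using ht), ← lintegral_const] at h1
    have hfin := (shiftEnergy_lt_top hκ hc hP hr hν).ne
    have hlt : ∀ᵐ x ∂(μ.toMeasure.restrict N),
        shiftPotential κ c ν x < 1 + c * ν.toMeasure univ := by
      filter_upwards [ae_restrict_mem hNm] with x hx
      rw [hN, mem_ofPred_eq, one_le_potential_iff hκ hc, not_le] at hx
      exact hx
    have heq := ae_eq_of_ae_le_of_lintegral_le (hlt.mono fun x hx => hx.le) hfin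
      aemeasurable_const h1
    have hfalse : ∀ᵐ x ∂(μ.toMeasure.restrict N), False := by
      filter_upwards [hlt, heq] with x h1 h2
      exact h1.ne h2
    change μ.toMeasure N = 0
    simpa [ae_iff] using hfalse

theorem Gam_mono {B : Set X} (hκ : IsKernel κ) (hAB : A ⊆ B) : Gam κ B ⊆ Gam κ A := by
  intro ν hν
  rw [mem_Gam_iff_ae hκ] at hν ⊢
  exact ⟨hν.1, fun K hKA => hν.2 K (hKA.trans hAB)⟩

/-- The constraints of `mem_Gam_iff` are affine; midpoints are the only convex combinations that the
parallelogram law needs. -/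
theorem midpoint_mem_Gam (hκ : IsKernel κ) (hP : PositiveDefinite κ) (hμ : μ ∈ Gam κ A)
    (hν : ν ∈ Gam κ A) : (1 / 2 : ℝ≥0) • (μ + ν) ∈ Gam κ A := by
  rw [mem_Gam_iff hκ hP] at hμ hν ⊢
  have hs := add_mem_finiteEnergy hκ hP hμ.1 hν.1
  refine ⟨smul_mem_finiteEnergy hκ _ hs, fun K hKA hK ρ hρ hρK => ?_⟩
  rw [form_smul_right hκ hP _ hs hρ, form_add_right hκ hP hμ.1 hν.1 hρ]
  have h1 := hμ.2 K hKA hK ρ hρ hρK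
  have h2 := hν.2 K hKA hK ρ hρ hρK
  push_cast
  linarith

theorem energy_le_iff (hκ : IsKernel κ) (hP : PositiveDefinite κ) (hμ : μ ∈ FiniteEnergy κ)
    (hν : ν ∈ FiniteEnergy κ) : energy κ μ ≤ energy κ ν ↔ form κ μ μ ≤ form κ ν ν := by
  rw [energy, energy, ← coe_form hκ hP hμ hμ, ← coe_form hκ hP hν hν, EReal.coe_le_coe_iff]

theorem isInnerCapacitaryMeasure_iff (hκ : IsKernel κ) (hP : PositiveDefinite κ) :
    IsInnerCapacitaryMeasure κ A γ ↔
      γ ∈ Gam κ A ∧ ∀ ν ∈ Gam κ A, form κ γ γ ≤ form κ ν ν :=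
  and_congr_right fun hγ => forall₂_congr fun _ hν => energy_le_iff hκ hP hγ.1 hν.1

theorem IsInnerCapacitaryMeasure.unique (hκ : IsKernel κ) (hperf : IsPerfect κ)
    (hμ : IsInnerCapacitaryMeasure κ A μ) (hν : IsInnerCapacitaryMeasure κ A ν) : μ = ν := by
  have hP := hperf.posDef
  rw [isInnerCapacitaryMeasure_iff hκ hP] at hμ hν
  refine eq_of_sqDist_eq_zero hperf.energyPrinciple hμ.1.1 hν.1.1 (le_antisymm ?_
    (sqDist_nonneg hκ hP hμ.1.1 hν.1.1))
  rw [sqDist_eq_midpoint hκ hP hμ.1.1 hν.1.1]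
  have h1 := hμ.2 _ (midpoint_mem_Gam hκ hP hμ.1 hν.1)
  have h2 := hν.2 _ hμ.1
  have h3 := hμ.2 _ hν.1
  linarith

end Gamma

/-! ### Capacitary measures of compact sets -/

section Compact

variable {X : Type*} [TopologicalSpace X] [T2Space X] [LocallyCompactSpace X]
  [MeasurableSpace X] [BorelSpace X] {κ : X → X → EReal}
  {μ ν γ : RadonMeasure X} {A K : Set X}

theorem exists_pos_le_form (hκ : IsKernel κ) (hP : PositiveDefinite κ)
    (hA : innerCapacity κ A < ⊤) : ∃ b : ℝ, 0 < b ∧ ∀ μ ∈ FiniteEnergy κ,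
      ConcentratedOn μ A → μ.toMeasure univ = 1 → b ≤ form κ μ μ := by
  have hne : minEnergy κ A ≠ 0 := by
    intro h
    simp [innerCapacity, h] at hA
  have hfin : min (minEnergy κ A) 1 ≠ ∞ := ne_top_of_le_ne_top ENNReal.one_ne_top (min_le_right _ _)
  -- Truncation at `1` keeps the bound real and positive when no admissible measure exists and the
  -- infimum is `∞`.
  refine ⟨(min (minEnergy κ A) 1).toReal, ENNReal.toReal_pos (by simpa using hne) hfin,
    fun μ hμ hcon hu => ?_⟩
  have h1 : minEnergy κ A ≤ (energy κ μ).toENNReal := iInf₂_le μ ⟨hμ, hcon, hu⟩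
  rw [energy, ← coe_form hκ hP hμ hμ, EReal.toENNReal_of_ne_top (EReal.coe_ne_top _),
    EReal.toReal_coe] at h1
  exact ENNReal.toReal_le_of_le_ofReal (form_self_nonneg hκ hP hμ) ((min_le_left _ _).trans h1)

theorem concentratedOn_of_compl (hKA : K ⊆ A) (h : μ.toMeasure Kᶜ = 0) : ConcentratedOn μ A :=
  fun _ _ => measure_mono_null (fun _ hx hxK => hx.2 (hKA hxK)) h

/-- Quadratic homogeneity extends the bound from unit measures; mass zero is covered by
nonnegativity of the energy. -/
theorem mul_sq_le_form (hκ : IsKernel κ) (hP : PositiveDefinite κ) (hK : IsCompact K) {b : ℝ}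
    (hb : ∀ μ ∈ FiniteEnergy κ, μ.toMeasure Kᶜ = 0 → μ.toMeasure univ = 1 → b ≤ form κ μ μ)
    (hμ : μ ∈ FiniteEnergy κ) (hμK : μ.toMeasure Kᶜ = 0) :
    b * (μ.toMeasure univ).toReal ^ 2 ≤ form κ μ μ := by
  by_cases h0 : μ.toMeasure univ = 0
  · simpa [h0] using form_self_nonneg hκ hP hμ
  · obtain ⟨h1, h2⟩ := smul_inv_univ hK hμK h0
    have h3 := hb _ (smul_mem_finiteEnergy hκ _ hμ) h2 h1
    have hpos : 0 < (μ.toMeasure univ).toReal :=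
      ENNReal.toReal_pos h0 (measure_univ_ne_top_of_compl hK hμK)
    rwa [form_smul_left hκ hP _ hμ (smul_mem_finiteEnergy hκ _ hμ),
      form_smul_right hκ hP _ hμ hμ, NNReal.coe_inv, ENNReal.coe_toNNReal_eq_toReal,
      ← mul_assoc, ← mul_inv, ← sq, le_inv_mul_iff₀ (by positivity), mul_comm] at h3

/-- Existence of a unit measure of minimal energy on a compact set. -/
theorem exists_minimal_unit_measure (hκ : IsKernel κ) (hperf : IsPerfect κ) (hK : IsCompact K)
    (hne : ∃ μ ∈ FiniteEnergy κ, μ.toMeasure Kᶜ = 0 ∧ μ.toMeasure univ = 1) :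
    ∃ l ∈ FiniteEnergy κ, l.toMeasure Kᶜ = 0 ∧ l.toMeasure univ = 1 ∧
      ∀ μ ∈ FiniteEnergy κ, μ.toMeasure Kᶜ = 0 → μ.toMeasure univ = 1 →
        form κ l l ≤ form κ μ μ := by
  have hP := hperf.posDef
  set V : Set (RadonMeasure X) :=
    {μ | μ ∈ FiniteEnergy κ ∧ μ.toMeasure Kᶜ = 0 ∧ μ.toMeasure univ = 1} with hV
  set S : Set ℝ := (fun μ => form κ μ μ) '' V with hS
  have hSne : S.Nonempty := by
    obtain ⟨μ, h⟩ := hne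
    exact ⟨_, mem_image_of_mem _ h⟩
  have hSb : BddBelow S := by
    refine ⟨0, ?_⟩
    rintro _ ⟨μ, hμ, rfl⟩
    exact form_self_nonneg hκ hP hμ.1
  have hmid : ∀ μ ∈ V, ∀ ν ∈ V, (1 / 2 : ℝ≥0) • (μ + ν) ∈ V := by
    intro μ hμ ν hν
    refine ⟨smul_mem_finiteEnergy hκ _ (add_mem_finiteEnergy hκ hP hμ.1 hν.1), ?_, ?_⟩
    · change ((1 / 2 : ℝ≥0) : ℝ≥0∞) * (μ.toMeasure Kᶜ + ν.toMeasure Kᶜ) = 0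
      simp [hμ.2.1, hν.2.1]
    · change ((1 / 2 : ℝ≥0) : ℝ≥0∞) * (μ.toMeasure univ + ν.toMeasure univ) = 1
      rw [hμ.2.2, hν.2.2, one_add_one_eq_two]
      simp [ENNReal.inv_mul_cancel]
  have hex : ∀ n : ℕ, ∃ μ ∈ V, form κ μ μ < sInf S + 1 / ((n : ℝ) + 1) := by
    intro n
    obtain ⟨_, ⟨μ, hμ, rfl⟩, h⟩ := exists_lt_of_csInf_lt hSne
      (lt_add_of_pos_right (sInf S) (show (0 : ℝ) < 1 / ((n : ℝ) + 1) by positivity))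
    exact ⟨μ, hμ, h⟩
  choose l hl hlf using hex
  have hlim : Tendsto (fun n : ℕ => 1 / ((n : ℝ) + 1)) atTop (𝓝 0) :=
    tendsto_one_div_add_atTop_nhds_zero_nat
  have hle : ∀ μ ∈ V, sInf S ≤ form κ μ μ := fun μ hμ => csInf_le hSb (mem_image_of_mem _ hμ)
  obtain ⟨γ, hγs, hγv⟩ := exists_tendsto_of_strongCauchy (F := atTop) (m := l) hκ hperf
    (fun n => (hl n).1) (strongCauchy_of_midpoint hκ hP (fun n => (hl n).1) fun ε hε =>
      ⟨sInf S, {n | 1 / ((n : ℝ) + 1) < ε}, hlim.eventually (gt_mem_nhds hε),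
        fun i hi => (hlf i).trans (by gcongr; exact hi),
        fun i _ j _ => hle _ (hmid _ (hl i) _ (hl j))⟩)
    (M := sInf S + 1) (fun n => (hlf n).le.trans (by
      gcongr
      rw [div_le_one (by positivity)]
      linarith [(Nat.cast_nonneg n : (0 : ℝ) ≤ n)]))
  obtain ⟨h1, h2⟩ := compl_eq_zero_and_univ_eq_of_tendsto_vague hK hγv (fun n => (hl n).2.1)
    (fun n => (hl n).2.2)
  refine ⟨γ, hγs.2.1, h1, h2, fun μ hμ hμK hμu => le_trans ?_ (hle μ ⟨hμ, hμK, hμu⟩)⟩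
  refine le_of_tendsto_of_tendsto' (tendsto_form_self_of_strongTendsto hκ hP hγs) ?_
    fun n => (hlf n).le
  simpa using hlim.const_add (sInf S)

/-- This is the first variation at the minimizer: the homogeneous bound for `l + tμ` is an equality
at `t = 0`, so the linear terms in `t` must compare. -/
theorem mul_univ_le_form_of_minimal (hκ : IsKernel κ) (hP : PositiveDefinite κ)
    (hK : IsCompact K) {l : RadonMeasure X} (hl : l ∈ FiniteEnergy κ)
    (hlK : l.toMeasure Kᶜ = 0) (hlu : l.toMeasure univ = 1)
    (hmin : ∀ μ ∈ FiniteEnergy κ, μ.toMeasure Kᶜ = 0 → μ.toMeasure univ = 1 →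
        form κ l l ≤ form κ μ μ)
    (hμ : μ ∈ FiniteEnergy κ) (hμK : μ.toMeasure Kᶜ = 0) :
    form κ l l * (μ.toMeasure univ).toReal ≤ form κ μ l := by
  set b := form κ l l with hb
  set a := (μ.toMeasure univ).toReal with ha
  have hμt := measure_univ_ne_top_of_compl hK hμK
  have h0 : b * a ^ 2 ≤ form κ μ μ := mul_sq_le_form hκ hP hK hmin hμ hμK
  have key : ∀ t : ℝ≥0, b * (1 + t * a) ^ 2 ≤ b + 2 * t * form κ μ l + t ^ 2 * form κ μ μ := by
    intro t
    have ht := smul_mem_finiteEnergy hκ t hμ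
    have hs := add_mem_finiteEnergy hκ hP hl ht
    have h1 := mul_sq_le_form hκ hP hK hmin hs (by
      change l.toMeasure Kᶜ + (t : ℝ≥0∞) * μ.toMeasure Kᶜ = 0
      simp [hlK, hμK])
    have h2 : (l + t • μ).toMeasure univ = 1 + t * μ.toMeasure univ := by
      change l.toMeasure univ + (t : ℝ≥0∞) * μ.toMeasure univ = _
      rw [hlu]
    rw [h2, ENNReal.toReal_add ENNReal.one_ne_top (ENNReal.mul_ne_top ENNReal.coe_ne_top hμt),
      ENNReal.toReal_mul, ENNReal.toReal_one, ENNReal.coe_toReal,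
      form_add_left hκ hP hl ht hs, form_add_right hκ hP hl ht hl, form_add_right hκ hP hl ht ht,
      form_smul_left hκ hP t hμ hl, form_smul_right hκ hP t hμ hl, form_smul_left hκ hP t hμ ht,
      form_smul_right hκ hP t hμ hμ, form_symm hκ l μ] at h1
    refine h1.trans (le_of_eq ?_)
    ring
  by_contra! hlt
  set d := b * a - form κ μ l with hd
  set Q := form κ μ μ - b * a ^ 2 with hQ
  have hd0 : 0 < d := by linarith
  have hQ0 : 0 ≤ Q := by linarith
  -- The variation reads `0 ≤ t(-2d + tQ)`. With `t = d / (Q + 1)` one has `tQ ≤ d`, so the bracket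
  -- is negative; the `+ 1` covers `Q = 0`.
  have hk := key ⟨d / (Q + 1), by positivity⟩
  change b * (1 + d / (Q + 1) * a) ^ 2 ≤
    b + 2 * (d / (Q + 1)) * form κ μ l + (d / (Q + 1)) ^ 2 * form κ μ μ at hk
  have h3 : 0 ≤ (d / (Q + 1)) * (-2 * d + d / (Q + 1) * Q) := by
    rw [hd, hQ]
    rw [hd, hQ] at hk
    linarith
  have h4 : 0 < d / (Q + 1) := by positivity
  have h5 := nonneg_of_mul_nonneg_right h3 h4
  have h6 : d / (Q + 1) * Q ≤ d := by
    rw [div_mul_eq_mul_div, div_le_iff₀ (by positivity)]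
    nlinarith
  linarith

/-- The inner capacitary measure of a compact set: existence, carrier and energy. -/
theorem exists_isInnerCapacitaryMeasure_of_isCompact (hκ : IsKernel κ) (hperf : IsPerfect κ)
    (hK : IsCompact K) {b : ℝ} (hb0 : 0 < b)
    (hb : ∀ μ ∈ FiniteEnergy κ, μ.toMeasure Kᶜ = 0 → μ.toMeasure univ = 1 → b ≤ form κ μ μ) :
    ∃ γ, IsInnerCapacitaryMeasure κ K γ ∧ γ.toMeasure Kᶜ = 0 ∧
      form κ γ γ = (γ.toMeasure univ).toReal ∧ form κ γ γ ≤ b⁻¹ := by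
  have hP := hperf.posDef
  simp_rw [isInnerCapacitaryMeasure_iff hκ hP]
  by_cases hne : ∃ μ ∈ FiniteEnergy κ, μ.toMeasure Kᶜ = 0 ∧ μ.toMeasure univ = 1
  · obtain ⟨l, hl, hlK, hlu, hmin⟩ := exists_minimal_unit_measure hκ hperf hK hne
    have hbl := hb l hl hlK hlu
    have hpos : 0 < form κ l l := hb0.trans_le hbl
    obtain ⟨t, ht⟩ : ∃ t : ℝ≥0, (t : ℝ) = (form κ l l)⁻¹ := ⟨⟨_, inv_nonneg.2 hpos.le⟩, rfl⟩
    have hγE := smul_mem_finiteEnergy hκ t hl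
    have hγ : form κ (t • l) (t • l) = (form κ l l)⁻¹ := by
      rw [form_smul_left hκ hP t hl hγE, form_smul_right hκ hP t hl hl, ht,
        inv_mul_cancel₀ hpos.ne', mul_one]
    refine ⟨t • l, ⟨(mem_Gam_iff hκ hP).2 ⟨hγE, fun L hLK hL μ hμ hμL => ?_⟩, fun ν hν => ?_⟩,
      ?_, ?_, ?_⟩
    · rw [form_smul_right hκ hP t hl hμ, ht, le_inv_mul_iff₀ hpos]
      exact mul_univ_le_form_of_minimal hκ hP hK hl hlK hlu hmin hμ
        (measure_mono_null (compl_subset_compl.2 hLK) hμL)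
    -- Minimality by Cauchy–Schwarz: the constraint tested at the unit measure `l` gives `1 ≤
    -- κ(l,ν)² ≤ κ(l,l) κ(ν,ν)`.
    · have h1 := ((mem_Gam_iff hκ hP).1 hν).2 K Subset.rfl hK l hl hlK
      rw [hlu, ENNReal.toReal_one] at h1
      have h2 := sq_form_le hκ hP hν.1 hl
      rw [hγ, inv_le_iff_one_le_mul₀' hpos]
      exact (one_le_pow₀ h1).trans h2
    · change (t : ℝ≥0∞) * l.toMeasure Kᶜ = 0
      rw [hlK, mul_zero]
    · change _ = ((t : ℝ≥0∞) * l.toMeasure univ).toReal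
      rw [hγ, hlu, mul_one, ENNReal.coe_toReal, ht]
    · rw [hγ]
      exact inv_anti₀ hb0 hbl
  -- Without unit measures of finite energy on `K`, every test measure is zero, so all constraints
  -- are void and `0` is the minimizer.
  · have hz := zero_mem_finiteEnergy (X := X) hκ
    have hz0 : form κ (0 : RadonMeasure X) 0 = 0 := form_zero_left hκ hP hz
    refine ⟨0, ⟨(mem_Gam_iff hκ hP).2 ⟨hz, fun L hLK hL μ hμ hμL => ?_⟩, fun ν hν => ?_⟩,
      by simp, by simp [hz0], by rw [hz0]; positivity⟩
    · have hμK := measure_mono_null (compl_subset_compl.2 hLK) hμL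
      have h0 : μ.toMeasure univ = 0 := by
        by_contra h0
        obtain ⟨h1, h2⟩ := smul_inv_univ hK hμK h0
        exact hne ⟨_, smul_mem_finiteEnergy hκ _ hμ, h2, h1⟩
      rw [h0, form_symm hκ, form_zero_left hκ hP hμ, ENNReal.toReal_zero]
    · rw [hz0]
      exact form_self_nonneg hκ hP hν.1

end Compact

/-! ### Passage to the limit along compact subsets -/

section Exhaustion

variable {X : Type*} [TopologicalSpace X] [T2Space X] [LocallyCompactSpace X]
  [MeasurableSpace X] [BorelSpace X] {κ : X → X → EReal}
  {μ ν γ : RadonMeasure X} {A K : Set X}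

instance (A : Set X) : Nonempty (CompactSubsets A) := ⟨⟨⊥, by simp⟩⟩

instance (A : Set X) : IsDirectedOrder (CompactSubsets A) :=
  ⟨fun K L => ⟨⟨K.1 ⊔ L.1, by simpa using ⟨K.2, L.2⟩⟩, le_sup_left (a := K.1),
    le_sup_right (a := K.1)⟩⟩

/-- Limits of capacitary measures of the compact subsets of `A` are capacitary for `A`. -/
theorem isInnerCapacitaryMeasure_of_strongTendsto (hκ : IsKernel κ) (hP : PositiveDefinite κ)
    {G : CompactSubsets A → RadonMeasure X}
    (hG : ∀ K : CompactSubsets A, IsInnerCapacitaryMeasure κ (K.1 : Set X) (G K))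
    (h : StrongTendsto κ G atTop γ) : IsInnerCapacitaryMeasure κ A γ := by
  simp only [isInnerCapacitaryMeasure_iff hκ hP] at hG ⊢
  refine ⟨(mem_Gam_iff hκ hP).2 ⟨h.2.1, fun K hKA hK μ hμ hμK => ?_⟩, fun ν hν => ?_⟩
  · refine ge_of_tendsto (tendsto_form_of_strongTendsto hκ hP h hμ) ?_
    filter_upwards [eventually_ge_atTop (⟨⟨K, hK⟩, hKA⟩ : CompactSubsets A)] with L hL
    exact ((mem_Gam_iff hκ hP).1 (hG L).1).2 K hL hK μ hμ hμK
  · exact le_of_tendsto' (tendsto_form_self_of_strongTendsto hκ hP h) fun K =>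
      (hG K).2 ν (Gam_mono hκ K.2 hν)

/-- Beyond a `K` whose energy nearly attains the supremum, all energies stay within `ε` above that
of `γ_K`, while midpoints lie in `Γ_K⁺` and cannot fall below it. -/
theorem exists_tendsto_of_isInnerCapacitaryMeasure (hκ : IsKernel κ) (hperf : IsPerfect κ)
    {G : CompactSubsets A → RadonMeasure X}
    (hG : ∀ K : CompactSubsets A, IsInnerCapacitaryMeasure κ (K.1 : Set X) (G K)) {M : ℝ}
    (hM : ∀ K, form κ (G K) (G K) ≤ M) :
    ∃ γ, StrongTendsto κ G atTop γ ∧ Tendsto G atTop (𝓝 γ) := by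
  have hP := hperf.posDef
  have hG' := hG
  simp only [isInnerCapacitaryMeasure_iff hκ hP] at hG'
  have hbdd : BddAbove (range fun K => form κ (G K) (G K)) := ⟨M, by rintro _ ⟨K, rfl⟩; exact hM K⟩
  refine exists_tendsto_of_strongCauchy hκ hperf (fun K => (hG K).1.1)
    (strongCauchy_of_midpoint hκ hP (fun K => (hG K).1.1) fun ε hε => ?_) hM
  obtain ⟨K, hK⟩ := exists_lt_of_lt_ciSup (sub_lt_self (⨆ K, form κ (G K) (G K)) hε)
  refine ⟨form κ (G K) (G K), Ici K, Ici_mem_atTop K, fun L _ => ?_, fun L hL L' hL' => ?_⟩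
  · have := le_ciSup hbdd L
    linarith
  · exact (hG' K).2 _ (midpoint_mem_Gam hκ hP (Gam_mono hκ hL (hG L).1)
      (Gam_mono hκ hL' (hG L').1))

end Exhaustion

/-! ### Potentials of capacitary measures and their vague semicontinuity -/

section Potentials

variable {X : Type*} [TopologicalSpace X] [T2Space X] [LocallyCompactSpace X]
  [MeasurableSpace X] [BorelSpace X] {κ : X → X → EReal} {ι : Type*}
  {m : ι → RadonMeasure X} {F : Filter ι} {μ ν γ : RadonMeasure X} {A K : Set X}

/-- Testing the constraint with `γ` itself gives `κγ ≥ 1` `γ`-a.e.; since `∫ κγ dγ = γ(X)`, there is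
no room for strict inequality. -/
theorem potential_eq_one_ae (hκ : IsKernel κ) (hP : PositiveDefinite κ) (hK : IsCompact K)
    (hγ : γ ∈ Gam κ K) (hγK : γ.toMeasure Kᶜ = 0)
    (hγu : form κ γ γ = (γ.toMeasure univ).toReal) :
    ∀ᵐ x ∂γ.toMeasure, potential κ γ x = 1 := by
  obtain ⟨c, hc⟩ := hκ.exists_isLowerBound
  have ht := measure_univ_ne_top_of_compl hK hγK
  have h1 := ((mem_Gam_iff_ae hκ).1 hγ).2 K Subset.rfl hK γ hγ.1 hγK
  have hfin := (shiftEnergy_lt_top hκ hc hP hγ.1 hγ.1).ne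
  have hm := hc.mul_mul_ne_top γ γ
  have hint : ∫⁻ x, shiftPotential κ c γ x ∂γ.toMeasure
      = ∫⁻ _, (1 + c * γ.toMeasure univ) ∂γ.toMeasure := by
    change shiftEnergy κ c γ γ = _
    rw [form_eq hκ hc hP hγ.1 hγ.1, sub_eq_iff_eq_add, ← ENNReal.toReal_add ht hm,
      ENNReal.toReal_eq_toReal_iff' hfin (ENNReal.add_ne_top.2 ⟨ht, hm⟩)] at hγu
    rw [hγu, lintegral_const, add_mul, one_mul]
  have heq := ae_eq_of_ae_le_of_lintegral_le (μ := γ.toMeasure)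
    (f := fun _ => 1 + c * γ.toMeasure univ) (g := shiftPotential κ c γ)
    (h1.mono fun x hx => (one_le_potential_iff hκ hc x).1 hx) (by rw [← hint]; exact hfin)
    (hκ.lowerSemicontinuous_shiftPotential γ).measurable.aemeasurable hint.le
  filter_upwards [heq] with x hx
  have hd := hc.mul_ne_top γ
  rw [hκ.potential_eq hc, ← hx]
  lift (c * γ.toMeasure univ : ℝ≥0∞) to ℝ≥0 using hd with d
  have : (((1 + d : ℝ≥0) : ℝ) - (d : ℝ) : ℝ) = 1 := by
    push_cast
    ring
  exact congrArg Real.toEReal this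

/-- Mass can escape in a vague limit, but the factor `c` vanishes unless `X` is compact, where the
constant `1` is a test function. -/
theorem tendsto_mul_univ_of_tendsto_vague {c : ℝ≥0} (hc : IsLowerBound κ c)
    (h : Tendsto m F (𝓝 μ)) :
    Tendsto (fun i => (c : ℝ≥0∞) * (m i).toMeasure univ) F (𝓝 (c * μ.toMeasure univ)) := by
  rcases hc.zero_or_compact with rfl | hX
  · simpa using tendsto_const_nhds
  · refine ENNReal.Tendsto.const_mul ?_ (Or.inr ENNReal.coe_ne_top)
    have h1 := tendsto_lintegral_of_tendsto_vague h ⟨ContinuousMap.const X 1,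
      HasCompactSupport.of_compactSpace _⟩
    simpa using h1

/-- The potential is vaguely lower semicontinuous: upper bounds pass to the limit. -/
theorem potential_le_of_tendsto_vague [F.NeBot] (hκ : IsKernel κ) (h : Tendsto m F (𝓝 μ)) {x : X}
    {s : EReal} (hs : ∀ i, potential κ (m i) x ≤ s) : potential κ μ x ≤ s := by
  obtain ⟨c, hc⟩ := hκ.exists_isLowerBound
  simp only [hκ.potential_eq hc] at hs ⊢
  have hcoe : ∀ ν : RadonMeasure X, ((c * ν.toMeasure univ : ℝ≥0∞) : EReal) ≠ ⊤ := fun ν => by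
    rw [Ne, EReal.coe_ennreal_eq_top_iff]
    exact hc.mul_ne_top ν
  have hbot : ∀ a : ℝ≥0∞, (a : EReal) ≠ ⊥ := fun a => EReal.coe_ennreal_ne_bot a
  simp only [EReal.sub_le_iff_le_add (Or.inl (hbot _)) (Or.inl (hcoe _))] at hs ⊢
  set d : RadonMeasure X → EReal := fun ν => ((c * ν.toMeasure univ : ℝ≥0∞) : EReal) with hd
  have hlim : Tendsto (fun i => s + d (m i)) F (𝓝 (s + d μ)) := by
    have h1 : Tendsto (fun i => d (m i)) F (𝓝 (d μ)) :=
      (continuous_coe_ennreal_ereal.tendsto _).comp (tendsto_mul_univ_of_tendsto_vague hc h)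
    exact (EReal.continuousAt_add (p := (s, d μ)) (Or.inr (hbot _)) (Or.inr (hcoe μ))).tendsto.comp
      (tendsto_const_nhds.prodMk_nhds h1)
  -- Nonnegativity makes the passage to `toENNReal` lossless, so that Fatou-type semicontinuity in
  -- `ℝ≥0∞` applies to the shifted potentials.
  have h0 : 0 ≤ s + d μ :=
    ge_of_tendsto' hlim fun i => (EReal.coe_ennreal_nonneg _).trans (hs i)
  have h2 : shiftPotential κ c μ x ≤ (s + d μ).toENNReal := by
    refine (lintegral_le_liminf_of_tendsto_vague h
      (hκ.lowerSemicontinuous_shift_right x)).trans ?_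
    rw [← ((EReal.continuous_toENNReal.tendsto _).comp hlim).liminf_eq]
    refine liminf_le_liminf (Eventually.of_forall fun i => ?_)
    have := EReal.toENNReal_le_toENNReal (hs i)
    rwa [EReal.toENNReal_coe] at this
  rw [← EReal.coe_toENNReal h0]
  exact_mod_cast h2

end Potentials

end PotentialTheory

/-! ### The main theorem -/

theorem mainTheorem7 {X : Type*} [TopologicalSpace X] [T2Space X] [LocallyCompactSpace X]
    [MeasurableSpace X] [BorelSpace X]
    (κ : X → X → EReal) (hκ : IsKernel κ) (hperf : IsPerfect κ)
    (A : Set X) (hA : innerCapacity κ A < ⊤) :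
    (∃! γ, IsInnerCapacitaryMeasure κ A γ) ∧
    (∀ K : CompactSubsets A, ∃! γ, IsInnerCapacitaryMeasure κ (K.1 : Set X) γ) ∧
    StrongTendsto κ (fun K : CompactSubsets A => innerCapacitaryMeasure κ (K.1 : Set X)) atTop
      (innerCapacitaryMeasure κ A) ∧
    Tendsto (fun K : CompactSubsets A => innerCapacitaryMeasure κ (K.1 : Set X)) atTop
      (𝓝 (innerCapacitaryMeasure κ A)) ∧
    (FirstMaximumPrinciple κ → SecondMaximumPrinciple κ →
      (∀ x : X,
        Monotone (fun K : CompactSubsets A =>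
          potential κ (innerCapacitaryMeasure κ (K.1 : Set X)) x) ∧
        Tendsto (fun K : CompactSubsets A =>
          potential κ (innerCapacitaryMeasure κ (K.1 : Set X)) x) atTop
          (𝓝 (potential κ (innerCapacitaryMeasure κ A) x))) ∧
      (∀ x : X, potential κ (innerCapacitaryMeasure κ A) x =
        ⨆ K : CompactSubsets A, potential κ (innerCapacitaryMeasure κ (K.1 : Set X)) x)) := by
  have hP := hperf.posDef
  obtain ⟨b, hb0, hb⟩ := exists_pos_le_form hκ hP hA
  have hspec : ∀ B : Set X, (∃ γ, IsInnerCapacitaryMeasure κ B γ) →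
      IsInnerCapacitaryMeasure κ B (innerCapacitaryMeasure κ B) := fun B h => by
    rw [innerCapacitaryMeasure, dif_pos h]
    exact h.choose_spec
  have hcompact : ∀ K : CompactSubsets A,
      IsInnerCapacitaryMeasure κ (K.1 : Set X) (innerCapacitaryMeasure κ (K.1 : Set X)) ∧
      (innerCapacitaryMeasure κ (K.1 : Set X)).toMeasure (K.1 : Set X)ᶜ = 0 ∧
      form κ (innerCapacitaryMeasure κ (K.1 : Set X)) (innerCapacitaryMeasure κ (K.1 : Set X))
        = ((innerCapacitaryMeasure κ (K.1 : Set X)).toMeasure Set.univ).toReal ∧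
      form κ (innerCapacitaryMeasure κ (K.1 : Set X)) (innerCapacitaryMeasure κ (K.1 : Set X))
        ≤ b⁻¹ := by
    intro K
    obtain ⟨γ, hγ, h⟩ := exists_isInnerCapacitaryMeasure_of_isCompact hκ hperf K.1.isCompact hb0
      fun μ hμ hμK => hb μ hμ (concentratedOn_of_compl K.2 hμK)
    have hs := hspec _ ⟨γ, hγ⟩
    -- Uniqueness transfers the carrier, mass and energy of the constructed measure to the one
    -- selected by choice.
    rw [hs.unique hκ hperf hγ]
    exact ⟨hγ, h⟩
  obtain ⟨γ, hγs, hγv⟩ := exists_tendsto_of_isInnerCapacitaryMeasure hκ hperf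
    (fun K => (hcompact K).1) (fun K => (hcompact K).2.2.2)
  have hγA := isInnerCapacitaryMeasure_of_strongTendsto hκ hP (fun K => (hcompact K).1) hγs
  have hAeq : innerCapacitaryMeasure κ A = γ := (hspec A ⟨γ, hγA⟩).unique hκ hperf hγA
  rw [hAeq]
  refine ⟨⟨γ, hγA, fun ν hν => hν.unique hκ hperf hγA⟩,
    fun K => ⟨_, (hcompact K).1, fun ν hν => hν.unique hκ hperf (hcompact K).1⟩, hγs, hγv,
    fun _ hdom => ?_⟩
  -- `γ_K`-a.e. one has `κγ_K = 1 ≤ κν`, and domination extends this to all of `X`. Taking `ν = γ_L`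
  -- gives monotonicity, and `ν = γ_A` one half of the supremum formula.
  have hle : ∀ (K : CompactSubsets A) (ν : RadonMeasure X), ν ∈ Gam κ (K.1 : Set X) →
      ∀ x, potential κ (innerCapacitaryMeasure κ (K.1 : Set X)) x ≤ potential κ ν x := by
    intro K ν hν
    obtain ⟨h1, h2, h3, -⟩ := hcompact K
    refine hdom _ h1.1.1 ν hν.1 ?_
    filter_upwards [potential_eq_one_ae hκ hP K.1.isCompact h1.1 h2 h3,
      ((mem_Gam_iff_ae hκ).1 hν).2 _ Set.Subset.rfl K.1.isCompact _ h1.1.1 h2] with x hx hx'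
    rw [hx]
    exact hx'
  have hmono : ∀ x, Monotone fun K : CompactSubsets A =>
      potential κ (innerCapacitaryMeasure κ (K.1 : Set X)) x := fun x K L hKL =>
    hle K _ (Gam_mono hκ hKL (hcompact L).1.1) x
  have hsup : ∀ x, potential κ γ x =
      ⨆ K : CompactSubsets A, potential κ (innerCapacitaryMeasure κ (K.1 : Set X)) x := fun x =>
    le_antisymm
      (potential_le_of_tendsto_vague hκ hγv fun K =>
        le_iSup (fun K : CompactSubsets A =>
          potential κ (innerCapacitaryMeasure κ (K.1 : Set X)) x) K)
      (iSup_le fun K => hle K γ (Gam_mono hκ K.2 hγA.1) x)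
  refine ⟨fun x => ⟨hmono x, ?_⟩, hsup⟩
  rw [hsup x]
  exact tendsto_atTop_iSup (hmono x)
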